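/- Let $[n]=\{1,\dots,n\}$. Let $NC(n)$ be the set of non-crossing partitions of $[n]$ and $\mathrm{Int}(n)\subseteq NC(n)$ the set of interval partitions (all blocks consist of consecutive integers). Order partitions by $\alpha\le\beta$ iff every block of $\alpha$ is contained in a block of $\beta$, and let $0_n$ be the partition into singletons. Identify a partition with the permutation of $[n]$ whose cycles are its blocks, each in increasing cyclic order; put $1_n=(1,2,\dots,n)$, and let $\|\sigma\|$ be the minimal number of transpositions whose product is $\sigma\in S_n$ (so $\|\sigma\|=n-\#\mathrm{cycles}(\sigma)$; a pair $\alpha,\beta\in NC(n)$ encodes a meandric system on $2n$ points with $n-\|\alpha^{-1}\beta\|$ loops). The Kreweras complement $\alpha^{\mathrm{Kr}}$ of $\alpha\in NC(n)$ is the largest $\beta\in NC(n)$ such that $\alpha$ on $\{1,\dots,n\}$ together with $\beta$ on $\{\bar1,\dots,\bar n\}$ is a non-crossing partition of the ordered set $1<\bar1<2<\bar2<\dots<n<\bar n$. Write $\mathrm{Kr}\,L=\{\alpha^{\mathrm{Kr}}:\alpha\in L\}$ and $\alpha\wedge_{\mathrm{Kr\,Int}}\beta=\max\{\gamma\in \mathrm{Kr\,Int}(n):\gamma\le\alpha,\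 \gamma\le\beta\}$. Define the moment and boolean cumulant generating functions of shallow top meandric systems, as formal power series in $X$ with coefficients that are polynomials in $Y,A,B$, by $$M(X,Y,A,B)=\sum_{n\ge1}X^n\sum_{\alpha\in \mathrm{Int}(n),\,\beta\in NC(n)}Y^{\|\alpha^{-1}\beta\|}A^{\|\alpha\|}B^{\|\beta\|},$$ $$K(X,Y,A,B)=\sum_{n\ge1}X^n\sum_{\substack{\alpha\in \mathrm{Kr\,Int}(n),\ \beta\in \mathrm{Kr}\,NC(n)\\ \alpha\wedge_{\mathrm{Kr\,Int}}\beta=0_n}}Y^{\|\alpha^{-1}\beta\|}A^{\|\alpha^{-1}1_n\|}B^{\|\beta^{-1}1_n\|}.$$ Let $g(X)=\sum_{n\ge1}g_nX^n$ and $h(X)=\sum_{n\ge1}h_nX^n$ with $$g_n=BY\left[(1+AY)^n+(AY)^n(Y^{-2}-1)\right],\qquad h_n=(AY)^{n-1},$$ and let $\hat g(X)=\sum_{n\ge1}\hat g_nX^n$ be the free transform of $g$, that is $\hat g_n=\sum_{\sigma\in NC(n)}\prod_{c\in\sigma}g_{|c|}$, the product being over the blocks $c$ of $\sigma$. Then $$K(X)=h\bigl(X(1+\hat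 g(X))\bigr)\qquad\text{and}\qquad M(X,Y,A,B)=\frac{K(X,Y,A,B)}{1-K(X,Y,A,B)}.$$ These identities hold for formal $Y,A,B$, and for $Y,A,B$ in any commutative ring with $Y$ invertible. -/

import Mathlib

open Finset

/-- Partitions of the `n`-element totally ordered set `Fin n` (standing for `[n] = {1, …, n}`).
The order of `Finpartition` is reversed refinement: `P ≤ Q` iff every block of `P` is contained in
a block of `Q`; `⊥` is the partition into singletons. -/
abbrev SetPartition (n : ℕ) : Type := Finpartition (univ : Finset (Fin n))

/-- No two distinct blocks `V`, `W` of the family cross. -/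
def NoncrossingBlocks {ι : Type*} [LinearOrder ι] (S : Finset (Finset ι)) : Prop :=
  ∀ V ∈ S, ∀ W ∈ S, V ≠ W → ¬ ∃ a ∈ V, ∃ b ∈ V, ∃ c ∈ W, ∃ d ∈ W, a < c ∧ c < b ∧ b < d

namespace SetPartition

/-- Every block consists of consecutive integers. -/
def IsInterval {n : ℕ} (P : SetPartition n) : Prop :=
  ∀ V ∈ P.parts, (V : Set (Fin n)).OrdConnected

open Classical in
/-- The set `NC(n)` of non-crossing partitions. -/
noncomputable def NC (n : ℕ) : Finset (SetPartition n) :=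
  univ.filter fun P => NoncrossingBlocks P.parts

open Classical in
/-- The set `Int(n)` of interval partitions. -/
noncomputable def Intv (n : ℕ) : Finset (SetPartition n) :=
  univ.filter fun P => P.IsInterval

/-- The permutation whose cycles are the blocks of `P`, each in increasing cyclic order. -/
def perm {n : ℕ} (P : SetPartition n) : Equiv.Perm (Fin n) where
  toFun i := ((P.part i).sort (· ≤ ·)).formPerm i
  invFun i := (((P.part i).sort (· ≤ ·)).formPerm)⁻¹ i
  left_inv i := by
    have h : P.part (((P.part i).sort (· ≤ ·)).formPerm i) = P.part i := by
      refine (P.mem_part_iff_part_eq_part (mem_univ _) (mem_univ _)).1 ?_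
      have := List.formPerm_apply_mem_of_mem (x := i) (l := (P.part i).sort (· ≤ ·))
        (by simp)
      exact (Finset.mem_sort _).1 this
    simp only [h]
    simp
  right_inv i := by
    have h : P.part ((((P.part i).sort (· ≤ ·)).formPerm)⁻¹ i) = P.part i := by
      refine (P.mem_part_iff_part_eq_part (mem_univ _) (mem_univ _)).1 ?_
      have := List.formPerm_mem_iff_mem (x := (((P.part i).sort (· ≤ ·)).formPerm)⁻¹ i)
        (l := (P.part i).sort (· ≤ ·))
      simpa using this
    simp only [h]
    simp

/-- The blocks of `P ⊔ Q` on the doubled set `1 < 1̄ < 2 < 2̄ < ⋯ < n < n̄`, where `P` lives on the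
points `i` and `Q` on the points `ī`. -/
def doubledBlocks {n : ℕ} (P Q : SetPartition n) : Finset (Finset (Fin n ×ₗ Bool)) :=
  P.parts.image (fun V => V.image fun i => toLex (i, false)) ∪
    Q.parts.image (fun W => W.image fun i => toLex (i, true))

/-- `Q` is the Kreweras complement of `P`: the largest non-crossing partition for which `P ⊔ Q` is
non-crossing on the doubled set. -/
def IsKreweras {n : ℕ} (P Q : SetPartition n) : Prop :=
  IsGreatest {Q' : SetPartition n | Q' ∈ NC n ∧ NoncrossingBlocks (doubledBlocks P Q')} Q

open Classical in
/-- The set `Kr L` of the Kreweras complements of the partitions in `L`. -/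
noncomputable def Kr {n : ℕ} (L : Finset (SetPartition n)) : Finset (SetPartition n) :=
  univ.filter fun Q => ∃ P ∈ L, IsKreweras P Q

/-- `R` is the meet of `P` and `Q` in `Kr Int(n)`: the largest element of `Kr Int(n)` that is
below both. -/
def IsKrIntMeet {n : ℕ} (P Q R : SetPartition n) : Prop :=
  IsGreatest {R' : SetPartition n | R' ∈ Kr (Intv n) ∧ R' ≤ P ∧ R' ≤ Q} R

end SetPartition

/-- The length `‖σ‖`: the minimal number of transpositions whose product is `σ`. -/
noncomputable def permLength {n : ℕ} (σ : Equiv.Perm (Fin n)) : ℕ :=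
  sInf {m : ℕ | ∃ l : List (Equiv.Perm (Fin n)),
    l.length = m ∧ (∀ τ ∈ l, τ.IsSwap) ∧ l.prod = σ}

namespace Meandric

open SetPartition

variable {R : Type*} [CommRing R]

/-- The power series `∑_{n ≥ 1} a n X ^ n`. -/
noncomputable def seriesFromOne (a : ℕ → R) : PowerSeries R :=
  PowerSeries.mk fun n => if n = 0 then 0 else a n

/-- The free transform: the coefficients of the result are
`m_n = ∑_{σ ∈ NC(n)} ∏_{c ∈ σ} κ_{|c|}`, `n ≥ 1`, where `κ_n` are the coefficients of `κ`. -/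
noncomputable def freeTransform (κ : PowerSeries R) : PowerSeries R :=
  seriesFromOne fun n => ∑ σ ∈ NC n, ∏ c ∈ σ.parts, PowerSeries.coeff c.card κ

/-- The generating function `M` of shallow top meandric systems. -/
noncomputable def momentSeries (Y A B : R) : PowerSeries R :=
  seriesFromOne fun n => ∑ α ∈ Intv n, ∑ β ∈ NC n,
    Y ^ permLength (α.perm⁻¹ * β.perm) * A ^ permLength α.perm * B ^ permLength β.perm

open Classical in
/-- The boolean cumulant generating function `K` of shallow top meandric systems; `finRotate n` is
the full cycle `1_n = (1, 2, …, n)` and `⊥` is `0_n`. -/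
noncomputable def cumulantSeries (Y A B : R) : PowerSeries R :=
  seriesFromOne fun n =>
    ∑ p ∈ (Kr (Intv n) ×ˢ Kr (NC n)).filter fun p => IsKrIntMeet p.1 p.2 ⊥,
      Y ^ permLength (p.1.perm⁻¹ * p.2.perm) * A ^ permLength (p.1.perm⁻¹ * finRotate n) *
        B ^ permLength (p.2.perm⁻¹ * finRotate n)

/-- The series `g`, with `g_n = BY[(1 + AY)^n + (AY)^n (Y⁻² - 1)]`. -/
noncomputable def gSeries (Y : Rˣ) (A B : R) : PowerSeries R :=
  seriesFromOne fun n =>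
    B * Y * ((1 + A * Y) ^ n + (A * Y) ^ n * (((Y⁻¹ : Rˣ) : R) ^ 2 - 1))

/-- The series `h`, with `h_n = (AY)^(n-1)`, `n ≥ 1`. -/
noncomputable def hSeries (Y A : R) : PowerSeries R :=
  seriesFromOne fun n => (A * Y) ^ (n - 1)

end Meandric

/-! On non-crossing partitions the Kreweras complement acts on permutations as `σ ↦ σ⁻¹ 1_n`
(`perm_krew`). It is therefore a bijection of `NC(n)`, and every length in `M` can be rewritten in
terms of complements. The complements of interval partitions are exactly the partitions `oneBlock T`
whose only possibly nontrivial block is a set `T` containing the last point. Hence `M` and `K` sum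
the same weight `pairWeight` over pairs `(T, P)` with `P ∈ NC(n)`. For `M` the set `T` only has to
contain the last point. For `K` it must meet the last block `V` of `P` in that point alone
(`isKrIntMeet_oneBlock_bot_iff`).

The heart of the proof is `permLength_oneBlock_inv_mul`: up to a global `1`, the length of `α⁻¹β` is
a sum over the blocks `c` of `P` that depends only on the sizes of `c` and `T ∩ c`. So the weight
factorizes over the blocks, and the sum over `T` becomes a product of independent sums over traces.
A block `c ≠ V` contributes `g_{|c|}`. The block `V` contributes `(AY)^(|V|-1)` for `K` and
`(1+AY)^(|V|-1)` for `M`.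

What remains is a sum over `NC(n)` with one weight on the block of the last point and the weight `g`
on the others. Cutting `[n]` at the points of that block leaves independent non-crossing partitions
of the gaps, so the sum is a coefficient of a series composed with `U = X(1+ĝ)`
(`coeff_subst_X_mul_freeTransform`). Thus `K = U/(1-AY·U)` and `M = U/(1-(1+AY)U)`, and `M =
K/(1-K)` follows by algebra. -/

/-! ### Cycle counts under multiplication by a transposition. -/

section CycleCount

set_option linter.unusedSectionVars false

open Equiv Equiv.Perm

variable {α : Type*} [Fintype α] [DecidableEq α]

/-- The number of cycles of a permutation, fixed points included. -/
noncomputable def cycleCount (σ : Perm α) : ℕ := Nat.card (Quotient (SameCycle.setoid σ))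

theorem sameCycle_apply_self (σ : Perm α) (x : α) : SameCycle σ x (σ x) := ⟨1, by simp⟩

/-- A set that contains `x` and is mapped into itself by `σ` contains the cycle of `x`. -/
theorem Equiv.Perm.SameCycle.mem_of_mapsTo {σ : Perm α} {S : Set α} (hS : ∀ x ∈ S, σ x ∈ S)
    {x y : α} (h : SameCycle σ x y) (hx : x ∈ S) : y ∈ S := by
  obtain ⟨k, -, -, rfl⟩ := h.exists_pow_eq'
  clear h
  induction k with
  | zero => simpa
  | succ k ih =>
    rw [pow_succ', Perm.mul_apply]
    exact hS _ ih

/-- If a relation is an equivalence containing all `(x, σ x)`, it contains `SameCycle σ`. -/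
theorem Equiv.Perm.SameCycle.rel_of_step {σ : Perm α} (s : Setoid α) (hs : ∀ x, s x (σ x))
    {x y : α} (h : SameCycle σ x y) : s x y :=
  h.mem_of_mapsTo (S := {y | s x y}) (fun z hz => s.trans hz (hs z)) (s.refl x)

/-- The product sends `i` to `σ j` and then follows the `σ`-cycle of `j` for as long as it meets
neither `i` nor `j`. It cannot meet `i`, so it comes back to `j`. -/
theorem sameCycle_mul_swap {σ : Perm α} {i j : α} (h : ¬ SameCycle σ i j) :
    SameCycle (σ * swap i j) i j := by
  by_contra hc
  have key : ∀ k : ℕ, ((σ * swap i j) ^ (k + 1)) i = (σ ^ (k + 1)) j := by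
    intro k
    induction k with
    | zero => simp
    | succ k ih =>
      rw [pow_succ', Perm.mul_apply, ih, pow_succ' σ (k + 1), Perm.mul_apply, Perm.mul_apply,
        swap_apply_of_ne_of_ne]
      · intro h'
        exact h (SameCycle.symm ⟨k + 1, by exact_mod_cast h'⟩)
      · intro h'
        exact hc ⟨k + 1, by rw [← ih] at h'; exact_mod_cast h'⟩
  have hpos := orderOf_pos σ
  have := key (orderOf σ - 1)
  rw [Nat.sub_add_cancel hpos, pow_orderOf_eq_one] at this
  exact hc ⟨orderOf σ, by exact_mod_cast this⟩

/-- For the least `k > 0` with `σ^k i = j`, the arc `σ i, …, σ^k i = j` is stable under the product,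
because `j` now goes to `σ i`. The arc contains `j` but not `i`. -/
theorem not_sameCycle_mul_swap {σ : Perm α} {i j : α} (hij : i ≠ j) (h : SameCycle σ i j) :
    ¬ SameCycle (σ * swap i j) i j := by
  classical
  have hex : ∃ k : ℕ, 0 < k ∧ (σ ^ k) i = j := by
    obtain ⟨k, hk, -, h⟩ := h.exists_pow_eq''
    exact ⟨k, hk, h⟩
  obtain ⟨hk0, hk⟩ := Nat.find_spec hex
  set k := Nat.find hex with hkdef
  have hmin : ∀ l, 0 < l → l < k → (σ ^ l) i ≠ j := fun l hl hlk hc =>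
    Nat.find_min hex hlk ⟨hl, hc⟩
  have hne : ∀ l, 0 < l → l ≤ k → (σ ^ l) i ≠ i := by
    intro l hl hlk hc
    rcases hlk.eq_or_lt with rfl | hlt
    · exact hij (hc.symm.trans hk)
    · refine hmin (k - l) (by omega) (by omega) ?_
      rw [← hk]
      conv_rhs => rw [← Nat.sub_add_cancel hlk, pow_add, Perm.mul_apply, hc]
  intro hc
  have := hc.symm.mem_of_mapsTo (S := {x | ∃ l, 0 < l ∧ l ≤ k ∧ (σ ^ l) i = x}) ?_
    ⟨k, hk0, le_rfl, hk⟩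
  · obtain ⟨l, hl, hlk, hli⟩ := this
    exact hne l hl hlk hli
  · rintro x ⟨l, hl, hlk, rfl⟩
    rcases hlk.eq_or_lt with rfl | hlt
    · refine ⟨1, one_pos, hk0, ?_⟩
      rw [hk]
      simp
    · refine ⟨l + 1, by omega, hlt, ?_⟩
      rw [Perm.mul_apply, swap_apply_of_ne_of_ne (hne l hl hlk) (hmin l hl hlt), pow_succ',
        Perm.mul_apply]

theorem cycleCount_mul_swap_of_not_sameCycle {σ : Perm α} {i j : α} (h : ¬ SameCycle σ i j) :
    cycleCount (σ * swap i j) + 1 = cycleCount σ := by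
  classical
  set τ := σ * swap i j with hτ
  have hij : SameCycle τ i j := sameCycle_mul_swap h
  have hστ : ∀ x, τ (swap i j x) = σ x := fun x => by simp [hτ]
  have hστ' : ∀ {x y}, SameCycle σ x y → SameCycle τ x y := by
    intro x y hxy
    refine hxy.rel_of_step (SameCycle.setoid τ) fun x => ?_
    change SameCycle τ x (σ x)
    rw [← hστ, sameCycle_apply_right]
    by_cases hxi : x = i
    · rw [hxi, swap_apply_left]; exact hij
    by_cases hxj : x = j
    · rw [hxj, swap_apply_right]; exact hij.symm
    · rw [swap_apply_of_ne_of_ne hxi hxj]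
  -- The equivalence relation that joins the two `σ`-cycles of `i` and `j` and keeps the others; it
  -- bounds the cycles of `τ` from above.
  let s : Setoid α :=
    { r := fun x y => SameCycle σ x y ∨
        ((SameCycle σ x i ∨ SameCycle σ x j) ∧ (SameCycle σ y i ∨ SameCycle σ y j))
      iseqv := by
        refine ⟨fun x => Or.inl (SameCycle.refl _ _), ?_, ?_⟩
        · rintro x y (h | ⟨h1, h2⟩)
          · exact Or.inl h.symm
          · exact Or.inr ⟨h2, h1⟩
        · rintro x y z (h | ⟨h1, h2⟩) (h' | ⟨h1', h2'⟩)
          · exact Or.inl (h.trans h')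
          · exact Or.inr ⟨h1'.imp h.trans h.trans, h2'⟩
          · exact Or.inr ⟨h1, h2.imp h'.symm.trans h'.symm.trans⟩
          · exact Or.inr ⟨h1, h2'⟩ }
  have hτs : ∀ {x y}, SameCycle τ x y → s x y := by
    intro x y hxy
    refine hxy.rel_of_step s fun x => ?_
    by_cases hxi : x = i
    · right
      subst hxi
      refine ⟨Or.inl (SameCycle.refl _ _), Or.inr ?_⟩
      simp [hτ, SameCycle.refl]
    by_cases hxj : x = j
    · right
      subst hxj
      refine ⟨Or.inr (SameCycle.refl _ _), Or.inl ?_⟩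
      simp [hτ, SameCycle.refl]
    · left
      rw [hτ, Perm.mul_apply, swap_apply_of_ne_of_ne hxi hxj]
      exact sameCycle_apply_self _ _
  let qj : Quotient (SameCycle.setoid σ) := Quotient.mk _ j
  -- After the merge the cycle of `j` is represented by that of `i`, so the cycles of `τ` correspond
  -- to the `σ`-cycles other than that of `j`.
  let f : {q : Quotient (SameCycle.setoid σ) // q ≠ qj} → Quotient (SameCycle.setoid τ) :=
    fun q => Quotient.lift (s := SameCycle.setoid σ) (Quotient.mk (SameCycle.setoid τ))
      (fun _ _ hxy => Quotient.sound (hστ' hxy)) q.1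
  have hf : Function.Bijective f := by
    constructor
    · rintro ⟨q, hq⟩ ⟨q', hq'⟩ hqq
      induction q using Quotient.inductionOn with | _ x
      induction q' using Quotient.inductionOn with | _ y
      have hxj : ¬ SameCycle σ x j := fun h => hq (Quotient.sound h)
      have hyj : ¬ SameCycle σ y j := fun h => hq' (Quotient.sound h)
      have hxy : SameCycle τ x y := Quotient.exact hqq
      apply Subtype.ext
      apply Quotient.sound
      rcases hτs hxy with h | ⟨h1, h2⟩
      · exact h
      · exact (h1.resolve_right hxj).trans (h2.resolve_right hyj).symm
    · intro q
      induction q using Quotient.inductionOn with | _ x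
      by_cases hxj : SameCycle σ x j
      · refine ⟨⟨Quotient.mk _ i, fun hc => h (Quotient.exact hc)⟩, ?_⟩
        exact Quotient.sound (hij.trans (hστ' hxj.symm))
      · exact ⟨⟨Quotient.mk _ x, fun hc => hxj (Quotient.exact hc)⟩, rfl⟩
  have hcard := Nat.card_congr (Equiv.ofBijective f hf)
  unfold cycleCount
  rw [← hcard]
  have : Nat.card {q : Quotient (SameCycle.setoid σ) // q ≠ qj} =
      Nat.card (Quotient (SameCycle.setoid σ)) - 1 := by
    rw [Nat.card_eq_fintype_card, Nat.card_eq_fintype_card, Fintype.card_subtype_compl,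
      Fintype.card_subtype_eq]
  rw [this]
  have : 0 < Nat.card (Quotient (SameCycle.setoid σ)) :=
    Nat.card_pos_iff.2 ⟨⟨qj⟩, inferInstance⟩
  omega

theorem cycleCount_mul_swap_of_sameCycle {σ : Perm α} {i j : α} (hij : i ≠ j)
    (h : SameCycle σ i j) : cycleCount (σ * swap i j) = cycleCount σ + 1 := by
  have := cycleCount_mul_swap_of_not_sameCycle (not_sameCycle_mul_swap hij h)
  rw [mul_assoc, swap_mul_self, mul_one] at this
  exact this.symm

theorem cycleCount_one : cycleCount (1 : Perm α) = Fintype.card α := by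
  rw [← Nat.card_eq_fintype_card]
  refine (Nat.card_congr (Equiv.ofBijective (Quotient.mk (SameCycle.setoid (1 : Perm α))) ?_)).symm
  exact ⟨fun x y h => sameCycle_one.1 (Quotient.exact h), Quotient.mk_surjective⟩

theorem cycleCount_inv (σ : Perm α) : cycleCount σ⁻¹ = cycleCount σ :=
  Nat.card_congr (Quotient.congr (Equiv.refl α) fun _ _ => sameCycle_inv)

theorem cycleCount_conj (σ g : Perm α) : cycleCount (g * σ * g⁻¹) = cycleCount σ :=
  Nat.card_congr (Quotient.congr g⁻¹ fun _ _ => sameCycle_conj)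

theorem cycleCount_le_card (σ : Perm α) : cycleCount σ ≤ Fintype.card α := by
  rw [← Nat.card_eq_fintype_card]
  exact Nat.card_le_card_of_surjective _ Quotient.mk_surjective

end CycleCount

/-! ### The length of a permutation through its number of cycles. -/

section PermLength

open Equiv Equiv.Perm

variable {n : ℕ}

/-- A transposition lowers the number of cycles by at most one, starting from the `n` cycles of the
identity. -/
theorem card_le_cycleCount_prod_add_length (l : List (Perm (Fin n))) (hl : ∀ τ ∈ l, τ.IsSwap) :
    n ≤ cycleCount l.prod + l.length := by
  induction l using List.reverseRecOn with
  | nil => simp [cycleCount_one]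
  | append_singleton l τ ih =>
    have ih' := ih fun τ h => hl τ (by simp [h])
    obtain ⟨i, j, hij, rfl⟩ := hl τ (by simp)
    rw [List.prod_append, List.prod_singleton, List.length_append, List.length_singleton]
    by_cases h : SameCycle l.prod i j
    · rw [cycleCount_mul_swap_of_sameCycle hij h]; omega
    · have := cycleCount_mul_swap_of_not_sameCycle h; omega

/-- Multiplying by `swap i (σ i)` for a point `i` that is not fixed splits off one more cycle. The
number `k` only bounds the cycles still missing and carries the induction. -/
theorem exists_swaps_prod_eq (k : ℕ) : ∀ σ : Perm (Fin n), n ≤ cycleCount σ + k →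
    ∃ l : List (Perm (Fin n)), l.length + cycleCount σ = n ∧ (∀ τ ∈ l, τ.IsSwap) ∧ l.prod = σ := by
  induction k with
  | zero =>
    intro σ hσ
    have hle := cycleCount_le_card σ
    rw [Fintype.card_fin] at hle
    refine ⟨[], by simp; omega, by simp, ?_⟩
    by_contra hne
    have : ∃ i, σ i ≠ i := by
      by_contra! hall
      exact hne (Equiv.ext hall).symm
    obtain ⟨i, hi⟩ := this
    have h1 := cycleCount_mul_swap_of_sameCycle hi.symm (sameCycle_apply_self σ i)
    have h2 := cycleCount_le_card (σ * swap i (σ i))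
    rw [Fintype.card_fin] at h2
    omega
  | succ k ih =>
    intro σ hσ
    by_cases hle : n ≤ cycleCount σ + k
    · exact ih σ hle
    have hne : σ ≠ 1 := by
      rintro rfl
      rw [cycleCount_one, Fintype.card_fin] at hle
      omega
    have : ∃ i, σ i ≠ i := by
      by_contra! hall
      exact hne (Equiv.ext hall)
    obtain ⟨i, hi⟩ := this
    have h1 := cycleCount_mul_swap_of_sameCycle hi.symm (sameCycle_apply_self σ i)
    obtain ⟨l, hl, hsw, hprod⟩ := ih (σ * swap i (σ i)) (by omega)
    refine ⟨l ++ [swap i (σ i)], by simp; omega, ?_, ?_⟩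
    · intro τ hτ
      rcases List.mem_append.1 hτ with h | h
      · exact hsw τ h
      · rw [List.mem_singleton.1 h]
        exact ⟨_, _, hi.symm, rfl⟩
    · rw [List.prod_append, hprod, List.prod_singleton, mul_assoc, swap_mul_self, mul_one]

/-- The length of a permutation is `n` minus the number of its cycles. -/
theorem permLength_add_cycleCount (σ : Perm (Fin n)) : permLength σ + cycleCount σ = n := by
  obtain ⟨l, hl, hsw, hprod⟩ := exists_swaps_prod_eq n σ (by omega)
  have hmem : l.length ∈ {m : ℕ | ∃ l : List (Perm (Fin n)),
    l.length = m ∧ (∀ τ ∈ l, τ.IsSwap) ∧ l.prod = σ} := ⟨l, rfl, hsw, hprod⟩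
  have h1 : permLength σ ≤ l.length := Nat.sInf_le hmem
  obtain ⟨l', hl', hsw', hprod'⟩ := Nat.sInf_mem ⟨_, hmem⟩
  have h2 := card_le_cycleCount_prod_add_length l' hsw'
  rw [hprod'] at h2
  have h3 : l'.length = permLength σ := hl'
  omega

theorem permLength_inv (σ : Perm (Fin n)) : permLength σ⁻¹ = permLength σ := by
  have h1 := permLength_add_cycleCount σ
  have h2 := permLength_add_cycleCount σ⁻¹
  rw [cycleCount_inv] at h2
  omega

theorem permLength_conj (σ g : Perm (Fin n)) : permLength (g * σ * g⁻¹) = permLength σ := by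
  have h1 := permLength_add_cycleCount σ
  have h2 := permLength_add_cycleCount (g * σ * g⁻¹)
  rw [cycleCount_conj] at h2
  omega

theorem permLength_mul_comm (σ τ : Perm (Fin n)) : permLength (σ * τ) = permLength (τ * σ) := by
  rw [← permLength_conj (τ * σ) σ]
  congr 1
  group

theorem permLength_swap_mul_of_sameCycle {σ : Perm (Fin n)} {i j : Fin n} (hij : i ≠ j)
    (h : SameCycle σ i j) : permLength (swap i j * σ) + 1 = permLength σ := by
  have h1 := permLength_add_cycleCount σ
  have h2 := permLength_add_cycleCount (σ * swap i j)
  have := cycleCount_mul_swap_of_sameCycle hij h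
  rw [permLength_mul_comm]
  omega

theorem permLength_swap_mul_of_not_sameCycle {σ : Perm (Fin n)} {i j : Fin n}
    (h : ¬ SameCycle σ i j) : permLength (swap i j * σ) = permLength σ + 1 := by
  have h1 := permLength_add_cycleCount σ
  have h2 := permLength_add_cycleCount (σ * swap i j)
  have := cycleCount_mul_swap_of_not_sameCycle h
  rw [permLength_mul_comm]
  omega

end PermLength

/-! ### Partitions described by `part`, and their permutations. -/

namespace SetPartition

variable {n : ℕ}

theorem mem_part_iff (P : SetPartition n) {i j : Fin n} : i ∈ P.part j ↔ P.part i = P.part j :=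
  P.mem_part_iff_part_eq_part (mem_univ _) (mem_univ _)

theorem part_mem_parts (P : SetPartition n) (i : Fin n) : P.part i ∈ P.parts :=
  P.part_mem.2 (mem_univ i)

theorem exists_part_eq (P : SetPartition n) {V : Finset (Fin n)} (hV : V ∈ P.parts) :
    ∃ i, P.part i = V := by
  obtain ⟨i, hi⟩ := P.nonempty_of_mem_parts hV
  exact ⟨i, P.part_eq_of_mem hV hi⟩

theorem le_iff_part (P Q : SetPartition n) :
    P ≤ Q ↔ ∀ i j, P.part i = P.part j → Q.part i = Q.part j := by
  constructor
  · intro h i j hij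
    obtain ⟨V, hV, hle⟩ := h (P.part_mem_parts i)
    have hi : i ∈ V := hle ((P.mem_part_iff).2 rfl)
    have hj : j ∈ V := hle ((P.mem_part_iff).2 hij.symm)
    rw [Q.part_eq_of_mem hV hi, Q.part_eq_of_mem hV hj]
  · intro h V hV
    obtain ⟨i, rfl⟩ := P.exists_part_eq hV
    refine ⟨Q.part i, Q.part_mem_parts i, fun j hj => ?_⟩
    exact Q.mem_part_iff.2 (h _ _ (P.mem_part_iff.1 hj))

theorem ext_part {P Q : SetPartition n}
    (h : ∀ i j, P.part i = P.part j ↔ Q.part i = Q.part j) : P = Q :=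
  le_antisymm ((le_iff_part P Q).2 fun i j => (h i j).1) ((le_iff_part Q P).2 fun i j => (h i j).2)

theorem part_bot_eq_iff {i j : Fin n} :
    (⊥ : SetPartition n).part i = (⊥ : SetPartition n).part j ↔ i = j := by
  constructor
  · intro h
    have h1 : ({j} : Finset (Fin n)) ∈ (⊥ : SetPartition n).parts :=
      Finpartition.mem_bot_iff.2 ⟨j, mem_univ _, rfl⟩
    have h2 : i ∈ (⊥ : SetPartition n).part j := (mem_part_iff _).2 h
    rw [Finpartition.part_eq_of_mem _ h1 (mem_singleton_self j)] at h2
    exact mem_singleton.1 h2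
  · rintro rfl; rfl

theorem mem_NC_iff {P : SetPartition n} :
    P ∈ NC n ↔ ∀ a b c d, a < c → c < b → b < d → P.part a = P.part b → P.part c = P.part d →
      P.part a = P.part c := by
  have hdef : P ∈ NC n ↔ NoncrossingBlocks P.parts := by simp [NC]
  rw [hdef]
  constructor
  · intro h a b c d hac hcb hbd hab hcd
    by_contra hne
    exact h _ (P.part_mem_parts a) _ (P.part_mem_parts c) hne
      ⟨a, P.mem_part_iff.2 rfl, b, P.mem_part_iff.2 hab.symm, c, P.mem_part_iff.2 rfl, d,
        P.mem_part_iff.2 hcd.symm, hac, hcb, hbd⟩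
  · rintro h V hV W hW hne ⟨a, ha, b, hb, c, hc, d, hd, hac, hcb, hbd⟩
    have ha' := P.part_eq_of_mem hV ha
    have hb' := P.part_eq_of_mem hV hb
    have hc' := P.part_eq_of_mem hW hc
    have hd' := P.part_eq_of_mem hW hd
    exact hne (by rw [← ha', ← hc', h a b c d hac hcb hbd (by rw [ha', hb']) (by rw [hc', hd'])])

theorem mem_Intv_iff {P : SetPartition n} :
    P ∈ Intv n ↔ ∀ a b c, a ≤ b → b ≤ c → P.part a = P.part c → P.part b = P.part c := by
  have hdef : P ∈ Intv n ↔ P.IsInterval := by simp [Intv]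
  rw [hdef]
  constructor
  · intro h a b c hab hbc hac
    have := (h _ (P.part_mem_parts c)).out (x := a) (y := c)
      (mem_coe.2 (P.mem_part_iff.2 hac)) (mem_coe.2 (P.mem_part_iff.2 rfl)) ⟨hab, hbc⟩
    exact P.mem_part_iff.1 (mem_coe.1 this)
  · intro h V hV
    obtain ⟨i, rfl⟩ := P.exists_part_eq hV
    refine ⟨fun x hx y hy z hz => ?_⟩
    have hx' := P.mem_part_iff.1 (mem_coe.1 hx)
    have hy' := P.mem_part_iff.1 (mem_coe.1 hy)
    exact mem_coe.2 (P.mem_part_iff.2 ((h x z y hz.1 hz.2 (hx'.trans hy'.symm)).trans hy'))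

theorem Intv_subset_NC : Intv n ⊆ NC n := by
  intro P hP
  rw [mem_Intv_iff] at hP
  rw [mem_NC_iff]
  intro a b c d hac hcb _ hab _
  exact hab.trans (hP a c b hac.le hcb.le hab).symm

/-! ### The permutation of a partition -/

theorem part_perm (P : SetPartition n) (i : Fin n) : P.part (P.perm i) = P.part i := by
  refine P.mem_part_iff.1 ?_
  have := List.formPerm_apply_mem_of_mem (x := i) (l := (P.part i).sort (· ≤ ·)) (by simp)
  exact (Finset.mem_sort _).1 this

/-- `P.perm i` is the next element of the block of `i`, in cyclic order. -/
theorem perm_spec (P : SetPartition n) (i : Fin n) :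
    (i < P.perm i ∧ ∀ j, P.part j = P.part i → i < j → P.perm i ≤ j) ∨
      ∀ j, P.part j = P.part i → P.perm i ≤ j ∧ j ≤ i := by
  set l := (P.part i).sort (· ≤ ·) with hl
  have hmem : ∀ j, P.part j = P.part i ↔ j ∈ l := fun j => by
    rw [hl, Finset.mem_sort, P.mem_part_iff]
  have hnd : l.Nodup := Finset.sort_nodup _ _
  have hs : l.SortedLT := Finset.sortedLT_sort _
  have hmono : StrictMono l.get := hs.strictMono_get
  obtain ⟨k, hk, hki⟩ := List.getElem_of_mem ((hmem i).1 rfl)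
  have hp : P.perm i = l.formPerm i := rfl
  have hf := List.formPerm_apply_getElem l hnd k hk
  rw [hki, ← hp] at hf
  by_cases hlast : k + 1 < l.length
  · left
    simp only [Nat.mod_eq_of_lt hlast] at hf
    refine ⟨?_, ?_⟩
    · rw [hf, ← hki]
      exact hmono (a := ⟨k, hk⟩) (b := ⟨k + 1, hlast⟩) (by simp)
    · intro j hj hij
      obtain ⟨m, hm, rfl⟩ := List.getElem_of_mem ((hmem j).1 hj)
      rw [← hki] at hij
      have : k < m := hmono.lt_iff_lt (a := ⟨k, hk⟩) (b := ⟨m, hm⟩) |>.1 hij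
      rw [hf]
      exact hmono.monotone (a := ⟨k + 1, hlast⟩) (b := ⟨m, hm⟩) (by simp; omega)
  · right
    have hk1 : k + 1 = l.length := by omega
    simp only [hk1, Nat.mod_self] at hf
    intro j hj
    obtain ⟨m, hm, rfl⟩ := List.getElem_of_mem ((hmem j).1 hj)
    constructor
    · rw [hf]
      exact hmono.monotone (a := ⟨0, by omega⟩) (b := ⟨m, hm⟩) (by simp)
    · rw [← hki]
      exact hmono.monotone (a := ⟨m, hm⟩) (b := ⟨k, hk⟩) (by simp; omega)

theorem lt_perm (P : SetPartition n) {i j : Fin n} (hj : P.part j = P.part i) (hij : i < j) :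
    i < P.perm i ∧ P.perm i ≤ j := by
  rcases P.perm_spec i with ⟨h1, h2⟩ | h
  · exact ⟨h1, h2 j hj hij⟩
  · exact absurd (h j hj).2 (not_le.2 hij)

theorem perm_le_of_max (P : SetPartition n) {i : Fin n} (hi : ∀ j, P.part j = P.part i → j ≤ i)
    {j : Fin n} (hj : P.part j = P.part i) : P.perm i ≤ j := by
  rcases P.perm_spec i with ⟨h1, h2⟩ | h
  · exact absurd (hi _ (P.part_perm i)) (not_le.2 h1)
  · exact (h j hj).1

theorem perm_eq_of_lt (P : SetPartition n) {i j : Fin n} (hj : P.part j = P.part i) (hij : i < j)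
    (hbet : ∀ k, i < k → k < j → P.part k ≠ P.part i) : P.perm i = j := by
  obtain ⟨h1, h2⟩ := P.lt_perm hj hij
  rcases h2.eq_or_lt with h | h
  · exact h
  · exact absurd (P.part_perm i) (hbet _ h1 h)

theorem perm_eq_of_max_min (P : SetPartition n) {i j : Fin n} (hj : P.part j = P.part i)
    (hi : ∀ k, P.part k = P.part i → j ≤ k ∧ k ≤ i) : P.perm i = j :=
  le_antisymm (P.perm_le_of_max (fun k hk => (hi k hk).2) hj) (hi _ (P.part_perm i)).1

theorem perm_eq_self (P : SetPartition n) {i : Fin n} (hi : ∀ k, P.part k = P.part i → k = i) :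
    P.perm i = i :=
  hi _ (P.part_perm i)

theorem sameCycle_perm_iff (P : SetPartition n) {i j : Fin n} :
    P.perm.SameCycle i j ↔ P.part i = P.part j := by
  constructor
  · intro h
    exact h.rel_of_step (Setoid.ker P.part) fun x => (P.part_perm x).symm
  -- Successive values of `P.perm` climb from the smaller point through the block until they reach
  -- the larger one.
  · suffices H : ∀ i j, i ≤ j → P.part i = P.part j → P.perm.SameCycle i j by
      intro h
      rcases le_total i j with hle | hle
      · exact H _ _ hle h
      · exact (H _ _ hle h.symm).symm
    intro i
    induction i using WellFoundedGT.induction with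
    | ind i ih =>
      intro j hij h
      rcases hij.eq_or_lt with rfl | hlt
      · exact Equiv.Perm.SameCycle.refl _ _
      · obtain ⟨h1, h2⟩ := P.lt_perm h.symm hlt
        exact (sameCycle_apply_self _ _).trans (ih _ h1 j h2 ((P.part_perm i).trans h))

theorem cycleCount_perm (P : SetPartition n) : cycleCount P.perm = #P.parts := by
  have hcard : #P.parts = Nat.card P.parts := by simp
  rw [hcard]
  let f : Quotient (Equiv.Perm.SameCycle.setoid P.perm) → P.parts :=
    Quotient.lift (fun i => (⟨P.part i, P.part_mem_parts i⟩ : P.parts))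
      fun i j h => Subtype.ext (P.sameCycle_perm_iff.1 h)
  refine Nat.card_congr (Equiv.ofBijective f ⟨?_, ?_⟩)
  · intro q q' h
    induction q using Quotient.inductionOn with | _ x
    induction q' using Quotient.inductionOn with | _ y
    exact Quotient.sound (P.sameCycle_perm_iff.2 (congrArg Subtype.val h))
  · rintro ⟨V, hV⟩
    obtain ⟨i, rfl⟩ := P.exists_part_eq hV
    exact ⟨Quotient.mk _ i, rfl⟩

theorem perm_injective : Function.Injective (perm : SetPartition n → Equiv.Perm (Fin n)) := by
  intro P Q h
  refine ext_part fun i j => ?_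
  rw [← sameCycle_perm_iff, ← sameCycle_perm_iff, h]

end SetPartition

/-! ### The Kreweras complement and the complements of interval partitions. -/

namespace SetPartition

variable {n : ℕ}

theorem part_ofSetoid_eq_iff (s : Setoid (Fin n)) [DecidableRel s.r] {i j : Fin n} :
    (Finpartition.ofSetoid s).part i = (Finpartition.ofSetoid s).part j ↔ s i j := by
  rw [← mem_part_iff, Finpartition.mem_part_ofSetoid_iff_rel]
  exact ⟨fun h => s.symm h, fun h => s.symm h⟩

/-- The equivalence relation whose only class that may fail to be a singleton is `T`. -/
def oneBlockSetoid (T : Finset (Fin n)) : Setoid (Fin n) :=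
  { r := fun i j => i = j ∨ (i ∈ T ∧ j ∈ T)
    iseqv := by
      refine ⟨fun x => Or.inl rfl, ?_, ?_⟩
      · rintro x y (rfl | ⟨h1, h2⟩)
        · exact Or.inl rfl
        · exact Or.inr ⟨h2, h1⟩
      · rintro x y z (rfl | ⟨h1, h2⟩) (rfl | ⟨h3, h4⟩)
        · exact Or.inl rfl
        · exact Or.inr ⟨h3, h4⟩
        · exact Or.inr ⟨h1, h2⟩
        · exact Or.inr ⟨h1, h4⟩ }

open Classical in
/-- The partition whose only block that may fail to be a singleton is `T`. -/
noncomputable def oneBlock (T : Finset (Fin n)) : SetPartition n :=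
  Finpartition.ofSetoid (oneBlockSetoid T)

open Classical in
theorem part_oneBlock_eq_iff {T : Finset (Fin n)} {i j : Fin n} :
    (oneBlock T).part i = (oneBlock T).part j ↔ i = j ∨ (i ∈ T ∧ j ∈ T) :=
  part_ofSetoid_eq_iff (oneBlockSetoid T)

/-- The equivalence relation of the Kreweras complement: `i < j` are related iff `(i, j]` is a
union of blocks of `P`. -/
def krewSetoid (P : SetPartition n) : Setoid (Fin n) :=
  { r := fun i j => ∀ x y, P.part x = P.part y → ((x ≤ i ↔ x ≤ j) ↔ (y ≤ i ↔ y ≤ j))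
    iseqv := by
      refine ⟨fun x => by simp, ?_, ?_⟩
      · intro i j h x y hxy
        have := h x y hxy
        tauto
      · intro i j k h h' x y hxy
        have h1 := h x y hxy
        have h2 := h' x y hxy
        tauto }

open Classical in
/-- The Kreweras complement. -/
noncomputable def krew (P : SetPartition n) : SetPartition n :=
  Finpartition.ofSetoid (krewSetoid P)

open Classical in
theorem part_krew_eq_iff {P : SetPartition n} {i j : Fin n} :
    (krew P).part i = (krew P).part j ↔
      ∀ x y, P.part x = P.part y → ((x ≤ i ↔ x ≤ j) ↔ (y ≤ i ↔ y ≤ j)) :=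
  part_ofSetoid_eq_iff (krewSetoid P)

/-- If `(a, b]` and `(c, d]` are unions of blocks and `a < c < b < d`, then so is `(a, c] = (a, b] \
(c, d]`. No assumption on `P` is needed. -/
theorem krew_mem_NC (P : SetPartition n) : krew P ∈ NC n := by
  rw [mem_NC_iff]
  intro a b c d hac hcb hbd hab hcd
  rw [part_krew_eq_iff] at *
  intro x y hxy
  have h1 := hab x y hxy
  have h2 := hcd x y hxy
  rcases lt_or_ge c x with hx | hx <;> rcases lt_or_ge c y with hy | hy <;> grind

theorem toLex_false_lt_true {i j : Fin n} : toLex (i, false) < toLex (j, true) ↔ i ≤ j := by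
  simp [Prod.Lex.toLex_lt_toLex, le_iff_lt_or_eq]

theorem toLex_true_lt_false {i j : Fin n} : toLex (i, true) < toLex (j, false) ↔ i < j := by
  simp [Prod.Lex.toLex_lt_toLex]

theorem toLex_lt_toLex_same {i j : Fin n} {b : Bool} : toLex (i, b) < toLex (j, b) ↔ i < j := by
  simp [Prod.Lex.toLex_lt_toLex]

theorem noncrossing_doubledBlocks_krew {P : SetPartition n} (hP : P ∈ NC n) :
    NoncrossingBlocks (doubledBlocks P (krew P)) := by
  have hQ := krew_mem_NC P
  rw [mem_NC_iff] at hP hQ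
  rintro V hV W hW hne ⟨a, ha, b, hb, c, hc, d, hd, hac, hcb, hbd⟩
  simp only [doubledBlocks, mem_union, mem_image] at hV hW
  rcases hV with ⟨V, hV, rfl⟩ | ⟨V, hV, rfl⟩ <;> rcases hW with ⟨W, hW, rfl⟩ | ⟨W, hW, rfl⟩ <;>
  · simp only [mem_image] at ha hb hc hd
    obtain ⟨a, ha, rfl⟩ := ha
    obtain ⟨b, hb, rfl⟩ := hb
    obtain ⟨c, hc, rfl⟩ := hc
    obtain ⟨d, hd, rfl⟩ := hd
    have ha' := Finpartition.part_eq_of_mem _ hV ha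
    have hb' := Finpartition.part_eq_of_mem _ hV hb
    have hc' := Finpartition.part_eq_of_mem _ hW hc
    have hd' := Finpartition.part_eq_of_mem _ hW hd
    have hab := ha'.trans hb'.symm
    have hcd := hc'.trans hd'.symm
    simp only [toLex_false_lt_true, toLex_true_lt_false, toLex_lt_toLex_same] at hac hcb hbd
    -- Two blocks of the same kind do not cross by `hP` or `hQ`. In a mixed crossing, a block of `P`
    -- has one point inside and one point outside an interval that must be a union of blocks of `P`.
    first
    | exact hne (by rw [← ha', ← hc', hP a b c d hac hcb hbd hab hcd])
    | exact hne (by rw [← ha', ← hc', hQ a b c d hac hcb hbd hab hcd])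
    | (have := part_krew_eq_iff.1 hcd a b hab
       grind)
    | (have := part_krew_eq_iff.1 hab c d hcd
       grind)

/-- If `ī` and `j̄` share a block, a block of `P` with points both inside and outside `(i, j]` would
cross it. So `(i, j]` is a union of blocks of `P`, which is the relation defining `krew P`. -/
theorem le_krew {P Q : SetPartition n} (h : NoncrossingBlocks (doubledBlocks P Q)) :
    Q ≤ krew P := by
  have key : ∀ i j x y, Q.part i = Q.part j → P.part x = P.part y → i < x → x ≤ j →
      (i < y ∧ y ≤ j) := by
    intro i j x y hij hxy hix hxj
    by_contra hc
    have hV : (P.part x).image (fun i => toLex (i, false)) ∈ doubledBlocks P Q :=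
      mem_union_left _ (mem_image_of_mem _ (P.part_mem_parts x))
    have hW : (Q.part i).image (fun i => toLex (i, true)) ∈ doubledBlocks P Q :=
      mem_union_right _ (mem_image_of_mem _ (Q.part_mem_parts i))
    have hx : toLex (x, false) ∈ (P.part x).image (fun i => toLex (i, false)) :=
      mem_image_of_mem _ (P.mem_part_iff.2 rfl)
    have hy : toLex (y, false) ∈ (P.part x).image (fun i => toLex (i, false)) :=
      mem_image_of_mem (fun i => toLex (i, false)) (P.mem_part_iff.2 hxy.symm)
    have hi : toLex (i, true) ∈ (Q.part i).image (fun i => toLex (i, true)) :=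
      mem_image_of_mem _ (Q.mem_part_iff.2 rfl)
    have hj : toLex (j, true) ∈ (Q.part i).image (fun i => toLex (i, true)) :=
      mem_image_of_mem (fun i => toLex (i, true)) (Q.mem_part_iff.2 hij.symm)
    have hne : (P.part x).image (fun i => toLex (i, false)) ≠
        (Q.part i).image (fun i => toLex (i, true)) := by
      intro he
      rw [he] at hx
      simp at hx
    by_cases hiy : i < y
    · have hjy : j < y := by
        by_contra hjy
        exact hc ⟨hiy, not_lt.1 hjy⟩
      exact h _ hW _ hV hne.symm ⟨_, hi, _, hj, _, hx, _, hy,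
        toLex_true_lt_false.2 hix, toLex_false_lt_true.2 hxj, toLex_true_lt_false.2 hjy⟩
    · exact h _ hV _ hW hne ⟨_, hy, _, hx, _, hi, _, hj,
        toLex_false_lt_true.2 (not_lt.1 hiy), toLex_true_lt_false.2 hix,
        toLex_false_lt_true.2 hxj⟩
  rw [le_iff_part]
  intro i j hij
  rw [part_krew_eq_iff]
  intro x y hxy
  have h1 := key i j x y hij hxy
  have h2 := key j i x y hij.symm hxy
  have h3 := key i j y x hij hxy.symm
  have h4 := key j i y x hij.symm hxy.symm
  grind

theorem isKreweras_iff {P Q : SetPartition n} (hP : P ∈ NC n) : IsKreweras P Q ↔ Q = krew P := by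
  have h : IsKreweras P (krew P) :=
    ⟨⟨krew_mem_NC P, noncrossing_doubledBlocks_krew hP⟩, fun Q hQ => le_krew hQ.2⟩
  constructor
  · intro hQ
    exact IsGreatest.unique hQ h
  · rintro rfl
    exact h

/-- Here `k` is the cyclic successor of `i` and `j` is the cyclic predecessor of `k` in its block of
`P`. Either `j < k` are neighbours in the block, or `k` is its least and `j` its largest point. -/
theorem krew_perm_apply {m : ℕ} {P : SetPartition (m + 1)} (hP : P ∈ NC (m + 1))
    (i j : Fin (m + 1)) (hj : P.perm j = finRotate (m + 1) i) : (krew P).perm i = j := by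
  rw [mem_NC_iff] at hP
  set k := finRotate (m + 1) i with hk
  have hjk : P.part k = P.part j := by rw [← hj, part_perm]
  have hki : (i = Fin.last m ∧ k = 0) ∨ (k : ℕ) = i + 1 := by
    rcases eq_or_ne i (Fin.last m) with h | h
    · left
      exact ⟨h, by rw [hk, h, finRotate_last]⟩
    · right
      rw [hk, coe_finRotate_of_ne_last h]
  rcases P.perm_spec j with ⟨h1, h2⟩ | h1 <;> rw [hj] at h1
  · rw [hj] at h2
    have hki : (k : ℕ) = i + 1 := by
      rcases hki with ⟨-, h⟩ | h
      · rw [h] at h1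
        exact absurd h1 (Fin.not_lt_zero j)
      · exact h
    have hnone : ∀ x, j < x → x < k → P.part x ≠ P.part j := fun x hx hx' hc =>
      absurd (h2 x hc hx) (not_le.2 hx')
    -- No point of the block of `j` lies strictly between `j` and `k`, so non-crossing makes the gap
    -- a union of blocks. Hence `j` and `i = k - 1` are the two ends of one class of `krew P`.
    have hout : ∀ x y, P.part x = P.part y → j < x → x < k → j < y ∧ y < k := by
      intro x y hxy hx hx'
      have hxj := hnone x hx hx'
      by_contra hc
      have hyj : y ≠ j := by rintro rfl; exact hxj hxy
      have hyk : y ≠ k := by rintro rfl; exact hxj (hxy.trans hjk)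
      rcases lt_or_gt_of_ne hyj with h | h
      · exact hxj (hxy.trans (hP y x j k h hx hx' hxy.symm hjk.symm))
      · have : k < y := by
          rcases lt_or_gt_of_ne hyk with h' | h'
          · exact absurd ⟨h, h'⟩ hc
          · exact h'
        exact hxj (hP j k x y hx hx' this hjk.symm hxy).symm
    apply perm_eq_of_max_min
    · rw [part_krew_eq_iff]
      intro x y hxy
      have h3 := hout x y hxy
      have h4 := hout y x hxy.symm
      simp only [Fin.lt_def, Fin.le_def] at *
      omega
    · intro l hl
      have := part_krew_eq_iff.1 hl j k hjk.symm
      simp only [Fin.lt_def, Fin.le_def] at *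
      omega
  -- Now `[k, j]` is spanned by one block and hence a union of blocks. If `k = 0` the cycle wraps
  -- from the last point to `j`; otherwise `[k, j] = (i, j]` and `j` is the next point of the class
  -- of `i`.
  · have hout : ∀ x y, P.part x = P.part y → k ≤ x → x ≤ j → k ≤ y ∧ y ≤ j := by
      intro x y hxy hkx hxj
      by_cases hx : P.part x = P.part j
      · exact h1 y (hxy.symm.trans hx)
      have hxj' : x < j := lt_of_le_of_ne hxj (by rintro rfl; exact hx rfl)
      have hkx' : k < x := lt_of_le_of_ne hkx (by rintro rfl; exact hx hjk)
      by_contra hc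
      rcases lt_or_ge y k with h | h
      · exact hx (hxy.trans ((hP y x k j h hkx' hxj' hxy.symm hjk).trans hjk))
      · have : j < y := by
          by_contra h'
          exact hc ⟨h, not_lt.1 h'⟩
        exact hx ((hP k j x y hkx' hxj' this hjk hxy).symm.trans hjk)
    have hkj : k ≤ j := (h1 j rfl).1
    have hlast := fun x : Fin (m + 1) => Fin.le_last x
    have hzero := fun x : Fin (m + 1) => Fin.zero_le x
    rcases hki with ⟨rfl, hk0⟩ | hki
    · apply perm_eq_of_max_min
      · rw [part_krew_eq_iff]
        intro x y hxy
        have h3 := hout x y hxy (hk0 ▸ hzero _)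
        have h4 := hout y x hxy.symm (hk0 ▸ hzero _)
        have := hlast x
        have := hlast y
        tauto
      · intro l hl
        have := part_krew_eq_iff.1 hl k j hjk
        have := hlast j
        have := hzero l
        simp_all
    · apply perm_eq_of_lt
      · rw [part_krew_eq_iff]
        intro x y hxy
        have h3 := hout x y hxy
        have h4 := hout y x hxy.symm
        simp only [Fin.lt_def, Fin.le_def] at *
        omega
      · simp only [Fin.lt_def, Fin.le_def] at *
        omega
      · intro l hil hlj hl
        have := part_krew_eq_iff.1 hl k j hjk
        simp only [Fin.lt_def, Fin.le_def] at *
        omega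

theorem perm_krew {P : SetPartition n} (hP : P ∈ NC n) :
    (krew P).perm = P.perm⁻¹ * finRotate n := by
  cases n with
  | zero => exact Subsingleton.elim _ _
  | succ m =>
    ext1 i
    exact krew_perm_apply hP i _ (by simp)

theorem krew_injOn_NC : Set.InjOn krew (NC n : Set (SetPartition n)) := by
  intro P hP Q hQ h
  apply perm_injective
  have := congrArg perm h
  rw [perm_krew hP, perm_krew hQ] at this
  exact inv_injective (mul_right_cancel this)

open Classical in
theorem Kr_eq_image {L : Finset (SetPartition n)} (hL : L ⊆ NC n) : Kr L = L.image krew := by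
  ext Q
  simp only [Kr, mem_filter, mem_univ, true_and, mem_image]
  constructor
  · rintro ⟨P, hP, h⟩
    exact ⟨P, hP, ((isKreweras_iff (hL hP)).1 h).symm⟩
  · rintro ⟨P, hP, rfl⟩
    exact ⟨P, hP, (isKreweras_iff (hL hP)).2 rfl⟩

/-- An injective map of a finite set into itself is onto. -/
theorem Kr_NC : Kr (NC n) = NC n := by
  classical
  rw [Kr_eq_image Subset.rfl]
  refine eq_of_subset_of_card_le ?_ ?_
  · intro Q hQ
    obtain ⟨P, -, rfl⟩ := mem_image.1 hQ
    exact krew_mem_NC P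
  · rw [card_image_of_injOn krew_injOn_NC]

theorem oneBlock_mem_NC (T : Finset (Fin n)) : oneBlock T ∈ NC n := by
  rw [mem_NC_iff]
  intro a b c d hac hcb hbd
  simp only [part_oneBlock_eq_iff]
  grind

theorem exists_krew_eq_oneBlock {m : ℕ} {P : SetPartition (m + 1)} (hP : P ∈ Intv (m + 1)) :
    ∃ T : Finset (Fin (m + 1)), Fin.last m ∈ T ∧ krew P = oneBlock T := by
  classical
  rw [mem_Intv_iff] at hP
  -- `T` is the set of right endpoints of the intervals: the points `i` such that no block continues
  -- beyond `i`.
  refine ⟨univ.filter fun i => ∀ x y, P.part x = P.part y → (x ≤ i ↔ y ≤ i), ?_, ?_⟩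
  · simp [Fin.le_last]
  -- A nonempty `(i, j]` that is a union of intervals starts just after one right endpoint and stops
  -- at another.
  have key : ∀ i j, i < j →
      (∀ x y, P.part x = P.part y → ((x ≤ i ↔ x ≤ j) ↔ (y ≤ i ↔ y ≤ j))) →
      ((∀ x y, P.part x = P.part y → x ≤ i → y ≤ i) ∧
        ∀ x y, P.part x = P.part y → x ≤ j → y ≤ j) := by
    intro i j hij h
    refine ⟨fun x y hxy hxi => ?_, fun x y hxy hxj => ?_⟩
    · by_contra hyi
      rcases le_or_gt y j with hyj | hyj
      · have := h x y hxy
        have := hxi.trans hij.le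
        tauto
      · have h2 := h j y (hP x j y (hxi.trans hij.le) hyj.le hxy)
        grind
    · by_contra hyj
      have h2 := h j y (hP x j y hxj (not_le.1 hyj).le hxy)
      grind
  refine ext_part fun i j => ?_
  rw [part_krew_eq_iff, part_oneBlock_eq_iff]
  simp only [mem_filter, mem_univ, true_and]
  constructor
  · intro h
    rcases lt_trichotomy i j with hij | hij | hij
    · obtain ⟨h1, h2⟩ := key i j hij h
      exact Or.inr ⟨fun x y hxy => ⟨h1 x y hxy, h1 y x hxy.symm⟩,
        fun x y hxy => ⟨h2 x y hxy, h2 y x hxy.symm⟩⟩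
    · exact Or.inl hij
    · obtain ⟨h1, h2⟩ := key j i hij fun x y hxy => by
        have := h x y hxy
        tauto
      exact Or.inr ⟨fun x y hxy => ⟨h2 x y hxy, h2 y x hxy.symm⟩,
        fun x y hxy => ⟨h1 x y hxy, h1 y x hxy.symm⟩⟩
  · rintro (rfl | ⟨h1, h2⟩) x y hxy
    · simp
    · rw [h1 x y hxy, h2 x y hxy]

theorem exists_oneBlock_eq_krew {m : ℕ} {T : Finset (Fin (m + 1))} (hT : Fin.last m ∈ T) :
    ∃ P ∈ Intv (m + 1), krew P = oneBlock T := by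
  classical
  -- The interval partition obtained by cutting after every point of `T`.
  let s : Setoid (Fin (m + 1)) :=
    { r := fun i j => ∀ t ∈ T, (i ≤ t ↔ j ≤ t)
      iseqv := ⟨fun _ _ _ => Iff.rfl, fun h t ht => (h t ht).symm,
        fun h h' t ht => (h t ht).trans (h' t ht)⟩ }
  let P : SetPartition (m + 1) := Finpartition.ofSetoid s
  have hPpart : ∀ {i j}, P.part i = P.part j ↔ ∀ t ∈ T, (i ≤ t ↔ j ≤ t) :=
    part_ofSetoid_eq_iff s
  have hPI : P ∈ Intv (m + 1) := by
    rw [mem_Intv_iff]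
    intro a b c hab hbc
    rw [hPpart, hPpart]
    intro h t ht
    have := h t ht
    exact ⟨fun hbt => this.1 (hab.trans hbt), fun hct => hbc.trans hct⟩
  refine ⟨P, hPI, ?_⟩
  -- A point outside `T` shares its block with its successor, so it cannot be related to another
  -- point in `krew P`.
  have hnext : ∀ i ∉ T, ∃ j : Fin (m + 1), (j : ℕ) = i + 1 ∧ P.part i = P.part j := by
    intro i hi
    have hne : i ≠ Fin.last m := by rintro rfl; exact hi hT
    refine ⟨finRotate (m + 1) i, coe_finRotate_of_ne_last hne, ?_⟩
    rw [hPpart]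
    intro t ht
    have hti : t ≠ i := by rintro rfl; exact hi ht
    have := coe_finRotate_of_ne_last hne
    simp only [Fin.le_def, ne_eq, Fin.ext_iff] at *
    omega
  refine ext_part fun i j => ?_
  rw [part_krew_eq_iff, part_oneBlock_eq_iff]
  constructor
  · intro h
    by_contra hc
    push Not at hc
    obtain ⟨hij, hc⟩ := hc
    by_cases hi : i ∈ T
    · obtain ⟨l, hl, hjl⟩ := hnext j (hc hi)
      have h1 := hPpart.1 hjl i hi
      have := h j l hjl
      simp only [Fin.le_def, ne_eq, Fin.ext_iff] at *
      omega
    · obtain ⟨l, hl, hil⟩ := hnext i hi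
      have := h i l hil
      simp only [Fin.le_def, ne_eq, Fin.ext_iff] at *
      omega
  · rintro (rfl | ⟨h1, h2⟩) x y hxy
    · simp
    · rw [hPpart.1 hxy i h1, hPpart.1 hxy j h2]

theorem mem_Kr_Intv_iff {m : ℕ} {Q : SetPartition (m + 1)} :
    Q ∈ Kr (Intv (m + 1)) ↔ ∃ T : Finset (Fin (m + 1)), Fin.last m ∈ T ∧ oneBlock T = Q := by
  classical
  rw [Kr_eq_image Intv_subset_NC, mem_image]
  constructor
  · rintro ⟨P, hP, rfl⟩
    obtain ⟨T, hT, h⟩ := exists_krew_eq_oneBlock hP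
    exact ⟨T, hT, h.symm⟩
  · rintro ⟨T, hT, rfl⟩
    exact exists_oneBlock_eq_krew hT

end SetPartition

/-! ### The length of `α⁻¹β` when `α` has a single nontrivial block. -/

namespace SetPartition

open Equiv Equiv.Perm

variable {n : ℕ}

theorem perm_oneBlock_of_notMem {T : Finset (Fin n)} {x : Fin n} (hx : x ∉ T) :
    (oneBlock T).perm x = x :=
  perm_eq_self _ fun k hk => by
    rcases part_oneBlock_eq_iff.1 hk with h | h
    · exact h
    · exact absurd h.2 hx

theorem perm_oneBlock_inv_of_notMem {T : Finset (Fin n)} {x : Fin n} (hx : x ∉ T) :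
    (oneBlock T).perm⁻¹ x = x := by
  rw [Perm.inv_eq_iff_eq, perm_oneBlock_of_notMem hx]

theorem perm_oneBlock_max {T : Finset (Fin n)} {s M : Fin n} (hs : s ∈ T) (hM : M ∈ T)
    (hmin : ∀ r ∈ T, s ≤ r) (hmax : ∀ r ∈ T, r ≤ M) : (oneBlock T).perm M = s := by
  apply perm_eq_of_max_min
  · exact part_oneBlock_eq_iff.2 (Or.inr ⟨hs, hM⟩)
  · intro k hk
    rcases part_oneBlock_eq_iff.1 hk with h | h
    · exact ⟨h ▸ hmin _ hM, h.le⟩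
    · exact ⟨hmin _ h.1, hmax _ h.1⟩

theorem perm_oneBlock_inv_spec {T : Finset (Fin n)} {s r : Fin n} (hs : s ∈ T) (hr : r ∈ T)
    (hrs : r < s) : (oneBlock T).perm⁻¹ s ∈ T ∧ (oneBlock T).perm⁻¹ s < s ∧
      ∀ q ∈ T, q < s → q ≤ (oneBlock T).perm⁻¹ s := by
  set p := (oneBlock T).perm⁻¹ s with hp
  have hps : (oneBlock T).perm p = s := by simp [hp]
  have hpart : (oneBlock T).part s = (oneBlock T).part p := by rw [← hps, part_perm]
  have hpT : p ∈ T := by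
    rcases part_oneBlock_eq_iff.1 hpart with h | h
    · exact h ▸ hs
    · exact h.2
  have hmem : ∀ q ∈ T, (oneBlock T).part q = (oneBlock T).part p := fun q hq =>
    part_oneBlock_eq_iff.2 (Or.inr ⟨hq, hpT⟩)
  rcases (oneBlock T).perm_spec p with ⟨h1, h2⟩ | h1
  · rw [hps] at h1 h2
    exact ⟨hpT, h1, fun q hq hqs => not_lt.1 fun hpq =>
      absurd (h2 q (hmem q hq) hpq) (not_le.2 hqs)⟩
  · rw [hps] at h1
    exact absurd (h1 r (hmem r hr)).1 (not_le.2 hrs)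

/-- Adding a new least point to the block multiplies its cycle by one transposition. This drives the
induction on `T` in `permLength_oneBlock_inv_mul`. -/
theorem perm_oneBlock_insert {T : Finset (Fin n)} {t M : Fin n} (ht : ∀ r ∈ T, t < r) (hM : M ∈ T)
    (hmax : ∀ r ∈ T, r ≤ M) :
    (oneBlock (insert t T)).perm = (oneBlock T).perm * swap t M := by
  have htT : t ∉ T := fun h => lt_irrefl _ (ht t h)
  ext1 x
  rw [Perm.mul_apply]
  by_cases hxt : x = t
  · subst hxt
    rw [swap_apply_left]
    have hne : T.Nonempty := ⟨M, hM⟩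
    rw [perm_oneBlock_max (T.min'_mem hne) hM (fun r hr => T.min'_le r hr) hmax]
    apply perm_eq_of_lt
    · exact part_oneBlock_eq_iff.2 (Or.inr ⟨mem_insert_of_mem (T.min'_mem hne),
        mem_insert_self _ _⟩)
    · exact ht _ (T.min'_mem hne)
    · intro k hk hk' hc
      rcases part_oneBlock_eq_iff.1 hc with h | h
      · exact hk.ne' h
      · rcases mem_insert.1 h.1 with h | h
        · exact hk.ne' h
        · exact absurd (T.min'_le k h) (not_le.2 hk')
  by_cases hxM : x = M
  · subst hxM
    rw [swap_apply_right, perm_oneBlock_of_notMem htT]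
    apply perm_oneBlock_max (mem_insert_self _ _) (mem_insert_of_mem hM)
    · intro r hr
      rcases mem_insert.1 hr with h | h
      · exact h.ge
      · exact (ht r h).le
    · intro r hr
      rcases mem_insert.1 hr with h | h
      · exact h ▸ (ht x hM).le
      · exact hmax r h
  rw [swap_apply_of_ne_of_ne hxt hxM]
  by_cases hxT : x ∈ T
  · have hxltM : x < M := lt_of_le_of_ne (hmax x hxT) hxM
    have hpM : (oneBlock T).part M = (oneBlock T).part x :=
      part_oneBlock_eq_iff.2 (Or.inr ⟨hM, hxT⟩)
    obtain ⟨h1, -⟩ := (oneBlock T).lt_perm hpM hxltM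
    have hyT : (oneBlock T).perm x ∈ T := by
      rcases part_oneBlock_eq_iff.1 ((oneBlock T).part_perm x) with h | h
      · rwa [h]
      · exact h.1
    apply perm_eq_of_lt
    · exact part_oneBlock_eq_iff.2 (Or.inr ⟨mem_insert_of_mem hyT, mem_insert_of_mem hxT⟩)
    · exact h1
    · intro k hk hk' hc
      rcases part_oneBlock_eq_iff.1 hc with h | h
      · exact hk.ne' h
      · rcases mem_insert.1 h.1 with h | h
        · exact absurd (ht x hxT) (not_lt.2 (h ▸ hk.le))
        · have := (oneBlock T).lt_perm (part_oneBlock_eq_iff.2 (Or.inr ⟨h, hxT⟩)) hk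
          exact absurd this.2 (not_le.2 hk')
  · rw [perm_oneBlock_of_notMem hxT, perm_oneBlock_of_notMem]
    simp [hxt, hxT]

/-- Starting from `x`, the permutation `α⁻¹β` follows the block of `x` until it meets its first
element `s` in `T`, from where it jumps to the predecessor of `s` in `T`. -/
theorem sameCycle_pred (P : SetPartition n) {T : Finset (Fin n)} {s : Fin n}
    (hmin : ∀ r ∈ T, P.part r = P.part s → s ≤ r) {x : Fin n} (hx : P.part x = P.part s)
    (hxs : x < s ∨ ∀ r ∈ T, P.part r = P.part s → r ≤ x) :
    SameCycle ((oneBlock T).perm⁻¹ * P.perm) x ((oneBlock T).perm⁻¹ s) := by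
  set σ := (oneBlock T).perm⁻¹ * P.perm with hσ
  have hstep : ∀ y, P.perm y ∉ T → SameCycle σ y (P.perm y) := by
    intro y hy
    have : σ y = P.perm y := by
      rw [hσ, Perm.mul_apply, perm_oneBlock_inv_of_notMem hy]
    rw [← this]
    exact sameCycle_apply_self σ y
  have hlast : ∀ y, P.perm y = s → SameCycle σ y ((oneBlock T).perm⁻¹ s) := by
    intro y hy
    rw [← hy]
    exact sameCycle_apply_self σ y
  have hlow : ∀ x, P.part x = P.part s → x < s →
      SameCycle σ x ((oneBlock T).perm⁻¹ s) := by
    intro x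
    induction x using WellFoundedGT.induction with
    | ind x ih =>
      intro hx hxs
      obtain ⟨h1, h2⟩ := P.lt_perm hx.symm hxs
      rcases h2.eq_or_lt with h | h
      · exact hlast x h
      · have hp : P.part (P.perm x) = P.part s := (P.part_perm x).trans hx
        refine (hstep x fun hT => ?_).trans (ih _ h1 hp h)
        exact absurd (hmin _ hT hp) (not_le.2 h)
  rcases hxs with hxs | hxs
  · exact hlow x hx hxs
  -- Past all points of `T` in the block, the orbit climbs to the largest point, wraps to the least
  -- one, which is at most `s`, and continues as in `hlow`.
  induction x using WellFoundedGT.induction with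
  | ind x ih =>
    have hp : P.part (P.perm x) = P.part s := (P.part_perm x).trans hx
    by_cases hmax : ∀ j, P.part j = P.part x → j ≤ x
    · have hle := P.perm_le_of_max hmax hx.symm
      rcases hle.eq_or_lt with h | h
      · exact hlast x h
      · refine (hstep x fun hT => ?_).trans (hlow _ hp h)
        exact absurd (hmin _ hT hp) (not_le.2 h)
    · push Not at hmax
      obtain ⟨j, hj, hxj⟩ := hmax
      obtain ⟨h1, h2⟩ := P.lt_perm hj hxj
      refine (hstep x fun hT => ?_).trans (ih _ h1 hp fun r hr hrs => (hxs r hr hrs).trans h1.le)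
      exact absurd (hxs _ hT hp) (not_le.2 h1)

theorem exists_min_part (P : SetPartition n) {T : Finset (Fin n)} {x u : Fin n} (hu : u ∈ T)
    (hux : P.part u = P.part x) :
    ∃ s ∈ T, P.part s = P.part x ∧ ∀ r ∈ T, P.part r = P.part s → s ≤ r := by
  classical
  have hne : (T.filter fun r => P.part r = P.part x).Nonempty := ⟨u, by simp [hu, hux]⟩
  have hm := mem_filter.1 (min'_mem _ hne)
  refine ⟨_, hm.1, hm.2, fun r hr hrs => min'_le _ _ ?_⟩
  exact mem_filter.2 ⟨hr, hrs.trans hm.2⟩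

/-- Here `hsat` says that the points of `T` up to `u` are closed under sharing a block of `P`. The
orbit jumps from `u` to the predecessor in `T` of the least point `m` of `T` in the block of `u`.
Non-crossing preserves the closure property, so the descent continues until `m` is the least point
of `T`, whose cyclic predecessor is `M`. -/
theorem sameCycle_max_of_saturated {P : SetPartition n} (hP : P ∈ NC n) {T : Finset (Fin n)}
    {M : Fin n} (hM : M ∈ T) (hmax : ∀ r ∈ T, r ≤ M) (u : Fin n) (hu : u ∈ T)
    (hsat : ∀ w ∈ T, w ≤ u → ∀ v ∈ T, P.part v = P.part w → v ≤ u) :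
    SameCycle ((oneBlock T).perm⁻¹ * P.perm) u M := by
  induction u using WellFoundedLT.induction with
  | ind u ih =>
    obtain ⟨m, hm, hmu, hmin⟩ := P.exists_min_part hu rfl
    have hcyc := P.sameCycle_pred hmin hmu.symm
      (Or.inr fun r hr hrm => hsat u hu le_rfl r hr (hrm.trans hmu))
    by_cases hmT : ∀ r ∈ T, m ≤ r
    · rwa [Perm.inv_eq_iff_eq.2 (perm_oneBlock_max hm hM hmT hmax).symm] at hcyc
    · push Not at hmT
      obtain ⟨r, hr, hrm⟩ := hmT
      obtain ⟨hpT, hpm, hpmax⟩ := perm_oneBlock_inv_spec hm hr hrm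
      have hmu' : m ≤ u := hmin u hu hmu.symm
      refine hcyc.trans (ih _ (hpm.trans_le hmu') hpT ?_)
      intro w hw hwp v hv hvw
      have hwm : w < m := hwp.trans_lt hpm
      by_contra hvp
      have hmv : m ≤ v := not_lt.1 fun h => hvp (hpmax v hv h)
      have hvu : v ≤ u := hsat w hw (hwm.le.trans hmu') v hv hvw
      have hwne : P.part w ≠ P.part m := fun h => absurd (hmin w hw h) (not_le.2 hwm)
      have hvm : v ≠ m := by rintro rfl; exact hwne hvw.symm
      have hvu' : v ≠ u := by rintro rfl; exact hwne (hvw.symm.trans hmu.symm)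
      exact hwne ((mem_NC_iff.1 hP) w v m u hwm (lt_of_le_of_ne hmv hvm.symm)
        (lt_of_le_of_ne hvu hvu') hvw.symm hmu)

/-- The first jump from `t` lands just before `s`, the least point of `T` in the block of `t`. Since
`t` lies below `T`, a block with points of `T` on both sides of `s` would cross that of `t`, so
`sameCycle_max_of_saturated` applies. -/
theorem sameCycle_max {P : SetPartition n} (hP : P ∈ NC n) {T : Finset (Fin n)} {t M u : Fin n}
    (ht : ∀ r ∈ T, t < r) (hM : M ∈ T) (hmax : ∀ r ∈ T, r ≤ M) (hu : u ∈ T)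
    (hut : P.part u = P.part t) : SameCycle ((oneBlock T).perm⁻¹ * P.perm) t M := by
  obtain ⟨s, hs, hst, hmin⟩ := P.exists_min_part hu hut
  have hcyc := P.sameCycle_pred hmin hst.symm (Or.inl (ht s hs))
  by_cases hsT : ∀ r ∈ T, s ≤ r
  · rwa [Perm.inv_eq_iff_eq.2 (perm_oneBlock_max hs hM hsT hmax).symm] at hcyc
  · push Not at hsT
    obtain ⟨r, hr, hrs⟩ := hsT
    obtain ⟨hpT, hps, hpmax⟩ := perm_oneBlock_inv_spec hs hr hrs
    refine hcyc.trans (sameCycle_max_of_saturated hP hM hmax _ hpT ?_)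
    intro w hw hwp v hv hvw
    have hws : w < s := hwp.trans_lt hps
    by_contra hvp
    have hsv : s ≤ v := not_lt.1 fun h => hvp (hpmax v hv h)
    have hwne : P.part w ≠ P.part s := fun h => absurd (hmin w hw h) (not_le.2 hws)
    have hvs : v ≠ s := by rintro rfl; exact hwne hvw.symm
    exact hwne (((mem_NC_iff.1 hP) t s w v (ht w hw) hws (lt_of_le_of_ne hsv hvs.symm) hst.symm
      hvw.symm).symm.trans hst.symm)

/-- A block that misses `T` is mapped into itself by `α⁻¹β`, which acts on it as `β`. -/
theorem not_sameCycle_max (P : SetPartition n) {T : Finset (Fin n)} {t M : Fin n} (hM : M ∈ T)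
    (hT : ∀ r ∈ T, P.part r ≠ P.part t) : ¬ SameCycle ((oneBlock T).perm⁻¹ * P.perm) t M := by
  intro h
  refine hT M hM (h.mem_of_mapsTo (S := {x | P.part x = P.part t}) ?_ rfl)
  intro x hx
  have hx' : P.part (P.perm x) = P.part t := (P.part_perm x).trans hx
  have hxT : P.perm x ∉ T := fun h => hT _ h hx'
  rw [Perm.mul_apply, perm_oneBlock_inv_of_notMem hxT]
  exact hx'

theorem permLength_perm_add (P : SetPartition n) : permLength P.perm + #P.parts = n := by
  rw [← cycleCount_perm, permLength_add_cycleCount]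

theorem oneBlock_singleton (i : Fin n) : oneBlock {i} = (⊥ : SetPartition n) := by
  refine ext_part fun x y => ?_
  rw [part_oneBlock_eq_iff, part_bot_eq_iff]
  simp only [mem_singleton]
  grind

theorem perm_bot : (⊥ : SetPartition n).perm = 1 :=
  Equiv.ext fun _ => perm_eq_self _ fun _ hk => part_bot_eq_iff.1 hk

/-- The contribution of a block `c` to the length of `α⁻¹β`, where `T` is the only nontrivial
block of `α`. -/
def blockLength (c s : Finset (Fin n)) : ℕ := if s = ∅ then #c - 1 else #c - #s + 1

/-- Induction on `T`, adding a new least point `t`, which multiplies `α⁻¹β` by `swap t M` with `M`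
the maximum of `T`. This splits a cycle if the block of `t` already meets `T` and merges two cycles
otherwise. The length changes by `-1` or `+1`, exactly as the `blockLength` of that block does. -/
theorem permLength_oneBlock_inv_mul {P : SetPartition n} (hP : P ∈ NC n) (T : Finset (Fin n))
    (hT : T.Nonempty) :
    permLength ((oneBlock T).perm⁻¹ * P.perm) + 1 = ∑ c ∈ P.parts, blockLength c (T ∩ c) := by
  induction T using Finset.induction_on_min with
  | empty => exact absurd hT (by simp)
  | insert t T ht ih =>
    have htT : t ∉ T := fun h => lt_irrefl _ (ht t h)
    have hsplit : ∀ S : Finset (Fin n), ∑ c ∈ P.parts, blockLength c (S ∩ c) =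
        blockLength (P.part t) (S ∩ P.part t) +
          ∑ c ∈ P.parts.erase (P.part t), blockLength c (S ∩ c) := fun S =>
      (add_sum_erase _ _ (P.part_mem_parts t)).symm
    have hrest : ∑ c ∈ P.parts.erase (P.part t), blockLength c (insert t T ∩ c) =
        ∑ c ∈ P.parts.erase (P.part t), blockLength c (T ∩ c) := by
      refine sum_congr rfl fun c hc => ?_
      rw [mem_erase] at hc
      rw [insert_inter_of_notMem]
      intro htc
      exact hc.1 (P.part_eq_of_mem hc.2 htc).symm
    have htmem : t ∈ P.part t := P.mem_part_iff.2 rfl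
    have hins : insert t T ∩ P.part t = insert t (T ∩ P.part t) := insert_inter_of_mem htmem
    have hcard : #(insert t (T ∩ P.part t)) = #(T ∩ P.part t) + 1 :=
      card_insert_of_notMem fun h => htT (mem_inter.1 h).1
    have hle : #(insert t (T ∩ P.part t)) ≤ #(P.part t) := by
      rw [← hins]
      exact card_le_card inter_subset_right
    have hnew : blockLength (P.part t) (insert t T ∩ P.part t) =
        #(P.part t) - (#(T ∩ P.part t) + 1) + 1 := by
      rw [blockLength, hins, hcard, if_neg (insert_ne_empty _ _)]
    rw [hsplit, hrest, hnew]
    rcases T.eq_empty_or_nonempty with rfl | hne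
    -- Base case `T = {t}`: here `α` is the identity, and the marked block contributes one more than
    -- its size minus one, which matches the `+ 1` in the statement.
    · have h1 := P.permLength_perm_add
      have h2 : ∑ c ∈ P.parts, #c = n := by
        rw [P.sum_card_parts, card_univ, Fintype.card_fin]
      have h3 : ∑ c ∈ P.parts, (blockLength c (∅ ∩ c) + 1) = ∑ c ∈ P.parts, #c := by
        refine sum_congr rfl fun c hc => ?_
        have := card_pos.2 (P.nonempty_of_mem_parts hc)
        simp only [blockLength, empty_inter, if_true]
        omega
      rw [sum_add_distrib, hsplit, sum_const, smul_eq_mul, mul_one] at h3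
      simp only [blockLength, empty_inter, if_true, card_empty] at h3 hle ⊢
      rw [LawfulSingleton.insert_empty_eq, oneBlock_singleton, perm_bot, inv_one, one_mul]
      have := card_pos.2 ⟨t, htmem⟩
      omega
    · have ih := ih hne
      rw [hsplit] at ih
      have hM := T.max'_mem hne
      have hmax := fun r hr => T.le_max' r hr
      have hperm : (oneBlock (insert t T)).perm⁻¹ * P.perm =
          swap t (T.max' hne) * ((oneBlock T).perm⁻¹ * P.perm) := by
        rw [perm_oneBlock_insert ht hM hmax, mul_inv_rev, swap_inv, mul_assoc]
      rw [hperm]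
      have htM : t ≠ T.max' hne := (ht _ hM).ne
      by_cases hu : ∃ u ∈ T, P.part u = P.part t
      · obtain ⟨u, hu, hut⟩ := hu
        have hlen := permLength_swap_mul_of_sameCycle htM (sameCycle_max hP ht hM hmax hu hut)
        have hne' : T ∩ P.part t ≠ ∅ :=
          Finset.Nonempty.ne_empty ⟨u, mem_inter.2 ⟨hu, P.mem_part_iff.2 hut⟩⟩
        have hold : blockLength (P.part t) (T ∩ P.part t) = #(P.part t) - #(T ∩ P.part t) + 1 :=
          if_neg hne'
        omega
      · push Not at hu
        have hlen := permLength_swap_mul_of_not_sameCycle (P.not_sameCycle_max hM hu)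
        have he : T ∩ P.part t = ∅ := by
          rw [eq_empty_iff_forall_notMem]
          intro u hu'
          exact hu u (mem_inter.1 hu').1 (P.mem_part_iff.1 (mem_inter.1 hu').2)
        have hold : blockLength (P.part t) (T ∩ P.part t) = #(P.part t) - 1 := if_pos he
        have hz : #(T ∩ P.part t) = 0 := by rw [he, card_empty]
        have := card_pos.2 ⟨t, htmem⟩
        omega

end SetPartition

/-! ### Non-crossing families of blocks on intervals of natural numbers -/

/-- The blocks of `π` form a non-crossing partition of the interval `[a, b)`. -/
structure IsNCFamily (a b : ℕ) (π : Finset (Finset ℕ)) : Prop where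
  nonempty : ∀ c ∈ π, c.Nonempty
  bounds : ∀ c ∈ π, ∀ x ∈ c, a ≤ x ∧ x < b
  cover : ∀ x, a ≤ x → x < b → ∃ c ∈ π, x ∈ c
  disj : ∀ c ∈ π, ∀ d ∈ π, ∀ x, x ∈ c → x ∈ d → c = d
  noncrossing : NoncrossingBlocks π

/-- `S`, together with the blocks of `π`, forms a non-crossing partition of the interval `[a, b)`,
and `S` is the block of the last point (empty if there is none). -/
structure IsPointedNC (a b : ℕ) (S : Finset ℕ) (π : Finset (Finset ℕ)) : Prop where
  nonempty : ∀ c ∈ π, c.Nonempty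
  bounds : ∀ c ∈ insert S π, ∀ x ∈ c, a ≤ x ∧ x < b
  cover : ∀ x, a ≤ x → x < b → ∃ c ∈ insert S π, x ∈ c
  disj : ∀ c ∈ insert S π, ∀ d ∈ insert S π, ∀ x, x ∈ c → x ∈ d → c = d
  noncrossing : NoncrossingBlocks (insert S π)
  last_mem : ∀ x, a ≤ x → x + 1 = b → x ∈ S
  notMem : S ∉ π

open Classical in
/-- The non-crossing partitions of `[a, b)`. -/
noncomputable def ncFamilies (a b : ℕ) : Finset (Finset (Finset ℕ)) :=
  (range b).powerset.powerset.filter (IsNCFamily a b)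

open Classical in
/-- The non-crossing partitions of `[a, b)` with the block of the last point singled out. -/
noncomputable def pointedNC (a b : ℕ) : Finset (Finset ℕ × Finset (Finset ℕ)) :=
  ((range b).powerset ×ˢ (range b).powerset.powerset).filter fun q => IsPointedNC a b q.1 q.2

theorem mem_ncFamilies {a b : ℕ} {π : Finset (Finset ℕ)} :
    π ∈ ncFamilies a b ↔ IsNCFamily a b π := by
  simp only [ncFamilies, mem_filter, mem_powerset, and_iff_right_iff_imp]
  intro h c hc
  rw [mem_powerset]
  exact fun x hx => mem_range.2 (h.bounds c hc x hx).2

theorem mem_pointedNC {a b : ℕ} {q : Finset ℕ × Finset (Finset ℕ)} :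
    q ∈ pointedNC a b ↔ IsPointedNC a b q.1 q.2 := by
  simp only [pointedNC, mem_filter, mem_product, mem_powerset, and_iff_right_iff_imp]
  intro h
  refine ⟨fun x hx => mem_range.2 (h.bounds _ (mem_insert_self _ _) x hx).2, fun c hc => ?_⟩
  rw [mem_powerset]
  exact fun x hx => mem_range.2 (h.bounds c (mem_insert_of_mem hc) x hx).2

theorem IsPointedNC.notMem_of_mem {a b : ℕ} {S : Finset ℕ} {π : Finset (Finset ℕ)}
    (h : IsPointedNC a b S π) {c : Finset ℕ} (hc : c ∈ π) {x : ℕ} (hx : x ∈ c) : x ∉ S := by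
  intro hxS
  have := h.disj c (mem_insert_of_mem hc) S (mem_insert_self _ _) x hx hxS
  exact h.notMem (this ▸ hc)

theorem IsPointedNC.ne_of_mem {a b : ℕ} {S : Finset ℕ} {π : Finset (Finset ℕ)}
    (h : IsPointedNC a b S π) {c : Finset ℕ} (hc : c ∈ π) : c ≠ S := by
  rintro rfl
  exact h.notMem hc

/-- Joining a pointed partition of `[a, v)` and a partition of `[v, b)` by the new last point `b`,
which is added to the block `S`. -/
theorem IsPointedNC.glue {a v b : ℕ} {S : Finset ℕ} {π₁ π₂ : Finset (Finset ℕ)} (hav : a ≤ v)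
    (hvb : v ≤ b) (h₁ : IsPointedNC a v S π₁) (h₂ : IsNCFamily v b π₂) :
    IsPointedNC a (b + 1) (insert b S) (π₁ ∪ π₂) := by
  have hS : ∀ x ∈ S, a ≤ x ∧ x < v := h₁.bounds S (mem_insert_self _ _)
  have hb₁ : ∀ c ∈ π₁, ∀ x ∈ c, a ≤ x ∧ x < v := fun c hc => h₁.bounds c (mem_insert_of_mem hc)
  have hb₂ := h₂.bounds
  refine ⟨?_, ?_, ?_, ?_, ?_, ?_, ?_⟩
  · intro c hc
    rcases mem_union.1 hc with h | h
    · exact h₁.nonempty c h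
    · exact h₂.nonempty c h
  · intro c hc x hx
    rcases mem_insert.1 hc with rfl | hc
    · rcases mem_insert.1 hx with rfl | hx
      · omega
      · have := hS x hx; omega
    · rcases mem_union.1 hc with h | h
      · have := hb₁ c h x hx; omega
      · have := hb₂ c h x hx; omega
  · intro x hax hxb
    rcases lt_or_ge x v with hxv | hxv
    · obtain ⟨c, hc, hxc⟩ := h₁.cover x hax hxv
      rcases mem_insert.1 hc with rfl | hc
      · exact ⟨_, mem_insert_self _ _, mem_insert_of_mem hxc⟩
      · exact ⟨c, mem_insert_of_mem (mem_union_left _ hc), hxc⟩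
    · rcases lt_or_ge x b with hxb' | hxb'
      · obtain ⟨c, hc, hxc⟩ := h₂.cover x hxv hxb'
        exact ⟨c, mem_insert_of_mem (mem_union_right _ hc), hxc⟩
      · obtain rfl : x = b := by omega
        exact ⟨_, mem_insert_self _ _, mem_insert_self _ _⟩
  · have hoff : ∀ c ∈ π₁ ∪ π₂, ∀ x ∈ c, x ∉ insert b S := by
      intro c hc x hx hxS
      rcases mem_union.1 hc with h | h
      · have := hb₁ c h x hx
        rcases mem_insert.1 hxS with rfl | hxS
        · omega
        · exact h₁.notMem_of_mem h hx hxS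
      · have := hb₂ c h x hx
        rcases mem_insert.1 hxS with rfl | hxS
        · omega
        · have := hS x hxS; omega
    intro c hc d hd x hxc hxd
    rcases mem_insert.1 hc with rfl | hc <;> rcases mem_insert.1 hd with rfl | hd
    · rfl
    · exact absurd hxc (hoff d hd x hxd)
    · exact absurd hxd (hoff c hc x hxc)
    · rcases mem_union.1 hc with hc | hc <;> rcases mem_union.1 hd with hd | hd
      · exact h₁.disj c (mem_insert_of_mem hc) d (mem_insert_of_mem hd) x hxc hxd
      · have := hb₁ c hc x hxc; have := hb₂ d hd x hxd; omega
      · have := hb₂ c hc x hxc; have := hb₁ d hd x hxd; omega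
      · exact h₂.disj c hc d hd x hxc hxd
  · rintro c hc d hd hne ⟨p, hp, q, hq, r, hr, s, hs, hpr, hrq, hqs⟩
    rcases mem_insert.1 hc with rfl | hc <;> rcases mem_insert.1 hd with rfl | hd
    · exact hne rfl
    · have hsb : s < b := by
        rcases mem_union.1 hd with h | h
        · have := hb₁ d h s hs; omega
        · exact (hb₂ d h s hs).2
      have hq' : q ∈ S := (mem_insert.1 hq).resolve_left (by omega)
      have hp' : p ∈ S := (mem_insert.1 hp).resolve_left (by omega)
      have hqv := hS q hq'
      have hd₁ : d ∈ π₁ := by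
        rcases mem_union.1 hd with h | h
        · exact h
        · have := hb₂ d h r hr; omega
      exact h₁.noncrossing S (mem_insert_self _ _) d (mem_insert_of_mem hd₁) (h₁.ne_of_mem hd₁).symm
        ⟨p, hp', q, hq', r, hr, s, hs, hpr, hrq, hqs⟩
    · have hqb : q < b := by
        rcases mem_union.1 hc with h | h
        · have := hb₁ c h q hq; omega
        · exact (hb₂ c h q hq).2
      have hr' : r ∈ S := (mem_insert.1 hr).resolve_left (by omega)
      have hrv := hS r hr'
      have hc₁ : c ∈ π₁ := by
        rcases mem_union.1 hc with h | h
        · exact h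
        · have := hb₂ c h p hp; omega
      have hqv := hb₁ c hc₁ q hq
      -- The fourth point of the crossing may be the new point `b`; the last point `v - 1` of the
      -- left part lies in `S` and replaces it.
      have hv : v - 1 ∈ S := h₁.last_mem (v - 1) (by omega) (by omega)
      have hqv' : q ≠ v - 1 := by
        intro h
        exact h₁.notMem_of_mem hc₁ hq (h ▸ hv)
      exact h₁.noncrossing c (mem_insert_of_mem hc₁) S (mem_insert_self _ _) (h₁.ne_of_mem hc₁)
        ⟨p, hp, q, hq, r, hr', v - 1, hv, hpr, hrq, by omega⟩
    · rcases mem_union.1 hc with hc | hc <;> rcases mem_union.1 hd with hd | hd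
      · exact h₁.noncrossing c (mem_insert_of_mem hc) d (mem_insert_of_mem hd) hne
          ⟨p, hp, q, hq, r, hr, s, hs, hpr, hrq, hqs⟩
      · have := hb₁ c hc q hq; have := hb₂ d hd r hr; omega
      · have := hb₂ c hc p hp; have := hb₁ d hd r hr; omega
      · exact h₂.noncrossing c hc d hd hne ⟨p, hp, q, hq, r, hr, s, hs, hpr, hrq, hqs⟩
  · intro x _ hx
    obtain rfl : x = b := by omega
    exact mem_insert_self _ _
  · intro h
    rcases mem_union.1 h with h | h
    · have := hb₁ _ h b (mem_insert_self _ _); omega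
    · have := hb₂ _ h b (mem_insert_self _ _); omega

/-- The least `v ≥ a` such that `S ⊆ [0, v)`. -/
def cutPoint (a : ℕ) (S : Finset ℕ) : ℕ := max a (S.sup (· + 1))

theorem le_cutPoint (a : ℕ) (S : Finset ℕ) : a ≤ cutPoint a S := le_max_left _ _

theorem lt_cutPoint {a x : ℕ} {S : Finset ℕ} (hx : x ∈ S) : x < cutPoint a S :=
  (Finset.le_sup (f := (· + 1)) hx).trans (le_max_right _ _)

theorem cutPoint_le {a b : ℕ} {S : Finset ℕ} (hab : a ≤ b) (hS : ∀ x ∈ S, x < b) :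
    cutPoint a S ≤ b :=
  max_le hab (Finset.sup_le fun x hx => hS x hx)

theorem pred_cutPoint_mem {a x : ℕ} {S : Finset ℕ} (hax : a ≤ x) (hx : x + 1 = cutPoint a S) :
    x ∈ S := by
  have h : S.sup (· + 1) = x + 1 := by
    unfold cutPoint at hx
    omega
  have hne : S.Nonempty := by
    rw [nonempty_iff_ne_empty]
    rintro rfl
    simp at h
  obtain ⟨y, hy, hy'⟩ := Finset.exists_mem_eq_sup S hne (· + 1)
  rw [h] at hy'
  obtain rfl : x = y := by simpa using hy'
  exact hy

theorem IsPointedNC.cutPoint_eq {a v : ℕ} {S : Finset ℕ} {π : Finset (Finset ℕ)} (hav : a ≤ v)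
    (h : IsPointedNC a v S π) : cutPoint a S = v := by
  refine le_antisymm (cutPoint_le hav fun x hx => (h.bounds S (mem_insert_self _ _) x hx).2) ?_
  rcases hav.eq_or_lt with rfl | hlt
  · exact le_cutPoint _ _
  · have := lt_cutPoint (a := a) (h.last_mem (v - 1) (by omega) (by omega))
    omega

section Split

variable {a b : ℕ} {S : Finset ℕ} {π : Finset (Finset ℕ)}

theorem IsPointedNC.cutPoint_erase_le (hab : a ≤ b) (h : IsPointedNC a (b + 1) S π) :
    cutPoint a (S.erase b) ≤ b := by
  refine cutPoint_le hab fun x hx => ?_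
  have := (h.bounds S (mem_insert_self _ _) x (mem_of_mem_erase hx)).2
  have := ne_of_mem_erase hx
  omega

/-- Every other block lies on one side of the cut point. -/
theorem IsPointedNC.lt_cutPoint_iff (hab : a ≤ b) (h : IsPointedNC a (b + 1) S π) {c : Finset ℕ}
    (hc : c ∈ π) {x y : ℕ} (hx : x ∈ c) (hy : y ∈ c) (hxv : x < cutPoint a (S.erase b)) :
    y < cutPoint a (S.erase b) := by
  by_contra hyv
  have hxa := h.bounds c (mem_insert_of_mem hc) x hx
  have hya := h.bounds c (mem_insert_of_mem hc) y hy
  have hbS : b ∈ S := h.last_mem b hab rfl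
  -- The point just before the cut lies in `S`, as does `b`, so a block with points on both sides of
  -- the cut would cross `S`.
  have hw := pred_cutPoint_mem (a := a) (S := S.erase b) (x := cutPoint a (S.erase b) - 1)
    (by omega) (by omega)
  have hwS := mem_of_mem_erase hw
  have hxw : x ≠ cutPoint a (S.erase b) - 1 := by
    intro he
    exact h.notMem_of_mem hc hx (by rw [he]; exact hwS)
  have hyb : y ≠ b := by
    rintro rfl
    exact h.notMem_of_mem hc hy hbS
  exact h.noncrossing c (mem_insert_of_mem hc) S (mem_insert_self _ _) (h.ne_of_mem hc)
    ⟨x, hx, y, hy, _, hwS, b, hbS, by omega, by omega, by omega⟩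

theorem IsPointedNC.split_left (hab : a ≤ b) (h : IsPointedNC a (b + 1) S π) :
    IsPointedNC a (cutPoint a (S.erase b)) (S.erase b)
      (π.filter fun c => ∀ x ∈ c, x < cutPoint a (S.erase b)) := by
  have hvb := h.cutPoint_erase_le hab
  have hbS : b ∈ S := h.last_mem b hab rfl
  set v := cutPoint a (S.erase b) with hv
  have hmem : ∀ c ∈ insert (S.erase b) (π.filter fun c => ∀ x ∈ c, x < v),
      (c = S.erase b) ∨ (c ∈ π ∧ ∀ x ∈ c, x < v) := by
    intro c hc
    simpa using hc
  refine ⟨?_, ?_, ?_, ?_, ?_, ?_, ?_⟩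
  · intro c hc
    exact h.nonempty c (mem_filter.1 hc).1
  · intro c hc x hx
    rcases hmem c hc with rfl | ⟨hc, hlt⟩
    · exact ⟨(h.bounds S (mem_insert_self _ _) x (mem_of_mem_erase hx)).1, lt_cutPoint hx⟩
    · exact ⟨(h.bounds c (mem_insert_of_mem hc) x hx).1, hlt x hx⟩
  · intro x hax hxv
    obtain ⟨c, hc, hxc⟩ := h.cover x hax (by omega)
    rcases mem_insert.1 hc with rfl | hc
    · exact ⟨_, mem_insert_self _ _, mem_erase.2 ⟨by omega, hxc⟩⟩
    · exact ⟨c, mem_insert_of_mem (mem_filter.2 ⟨hc, fun y hy =>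
        h.lt_cutPoint_iff hab hc hxc hy hxv⟩), hxc⟩
  · intro c hc d hd x hxc hxd
    rcases hmem c hc with rfl | ⟨hc, -⟩ <;> rcases hmem d hd with rfl | ⟨hd, -⟩
    · rfl
    · exact absurd (mem_of_mem_erase hxc) (h.notMem_of_mem hd hxd)
    · exact absurd (mem_of_mem_erase hxd) (h.notMem_of_mem hc hxc)
    · exact h.disj c (mem_insert_of_mem hc) d (mem_insert_of_mem hd) x hxc hxd
  · rintro c hc d hd hne ⟨p, hp, q, hq, r, hr, s, hs, hlt⟩
    rcases hmem c hc with rfl | ⟨hc, -⟩ <;> rcases hmem d hd with rfl | ⟨hd, -⟩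
    · exact hne rfl
    · exact h.noncrossing S (mem_insert_self _ _) d (mem_insert_of_mem hd) (h.ne_of_mem hd).symm
        ⟨p, mem_of_mem_erase hp, q, mem_of_mem_erase hq, r, hr, s, hs, hlt⟩
    · exact h.noncrossing c (mem_insert_of_mem hc) S (mem_insert_self _ _) (h.ne_of_mem hc)
        ⟨p, hp, q, hq, r, mem_of_mem_erase hr, s, mem_of_mem_erase hs, hlt⟩
    · exact h.noncrossing c (mem_insert_of_mem hc) d (mem_insert_of_mem hd) hne
        ⟨p, hp, q, hq, r, hr, s, hs, hlt⟩
  · intro x hax hx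
    exact pred_cutPoint_mem hax hx
  · intro hc
    have hc' := (mem_filter.1 hc).1
    obtain ⟨x, hx⟩ := h.nonempty _ hc'
    exact h.notMem_of_mem hc' hx (mem_of_mem_erase hx)

theorem IsPointedNC.split_right (hab : a ≤ b) (h : IsPointedNC a (b + 1) S π) :
    IsNCFamily (cutPoint a (S.erase b)) b
      (π.filter fun c => ¬ ∀ x ∈ c, x < cutPoint a (S.erase b)) := by
  have hbS : b ∈ S := h.last_mem b hab rfl
  refine ⟨?_, ?_, ?_, ?_, ?_⟩
  · intro c hc
    exact h.nonempty c (mem_filter.1 hc).1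
  · intro c hc x hx
    rw [mem_filter] at hc
    obtain ⟨hc, hv⟩ := hc
    push Not at hv
    obtain ⟨y, hy, hyv⟩ := hv
    have hxb := h.bounds c (mem_insert_of_mem hc) x hx
    have hne : x ≠ b := by
      rintro rfl
      exact h.notMem_of_mem hc hx hbS
    refine ⟨not_lt.1 fun hxv => ?_, by omega⟩
    exact absurd (h.lt_cutPoint_iff hab hc hx hy hxv) (not_lt.2 hyv)
  · intro x hvx hxb
    obtain ⟨c, hc, hxc⟩ := h.cover x ((le_cutPoint _ _).trans hvx) (by omega)
    rcases mem_insert.1 hc with rfl | hc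
    · have := lt_cutPoint (a := a) (mem_erase.2 ⟨hxb.ne, hxc⟩)
      omega
    · exact ⟨c, mem_filter.2 ⟨hc, fun hall => absurd (hall x hxc) (not_lt.2 hvx)⟩, hxc⟩
  · intro c hc d hd
    exact h.disj c (mem_insert_of_mem (mem_filter.1 hc).1) d
      (mem_insert_of_mem (mem_filter.1 hd).1)
  · intro c hc d hd
    exact h.noncrossing c (mem_insert_of_mem (mem_filter.1 hc).1) d
      (mem_insert_of_mem (mem_filter.1 hd).1)

end Split

/-! ### Weighted sums over non-crossing partitions with a marked last block. -/

section Sums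

variable {R : Type*} [CommRing R]

/-- The sum over the non-crossing partitions of `[a, b)` of the product of `h` at the size of the
block of the last point and of `g` at the sizes of the other blocks. -/
noncomputable def pointedSum (g h : ℕ → R) (a b : ℕ) : R :=
  ∑ q ∈ pointedNC a b, h #q.1 * ∏ c ∈ q.2, g #c

/-- The sum over the non-crossing partitions of `[a, b)` of the product of `g` at the sizes of the
blocks. -/
noncomputable def familySum (g : ℕ → R) (a b : ℕ) : R :=
  ∑ π ∈ ncFamilies a b, ∏ c ∈ π, g #c

/-- Remove the last point `b` from its block `S` and let `v` be one more than the previous point of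
`S`, or `a` if there is none. The gap `[v, b)` is partitioned independently, and the rest of `S` is
the last block of `[a, v)`, empty when `v = a`. The lost point accounts for the shift of `h`. -/
theorem pointedSum_succ (g h : ℕ → R) {a b : ℕ} (hab : a ≤ b) :
    pointedSum g h a (b + 1) =
      ∑ v ∈ Ico a (b + 1), pointedSum g (fun k => h (k + 1)) a v * familySum g v b := by
  simp only [pointedSum, familySum, sum_mul_sum]
  rw [sum_congr rfl fun v _ => (sum_product' (pointedNC a v) (ncFamilies v b)
    fun q π => (h (#q.1 + 1) * ∏ c ∈ q.2, g #c) * ∏ c ∈ π, g #c).symm, sum_sigma']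
  symm
  refine sum_nbij'
    (fun z => (insert b z.2.1.1, z.2.1.2 ∪ z.2.2))
    (fun q => ⟨cutPoint a (q.1.erase b), ((q.1.erase b,
      q.2.filter fun c => ∀ x ∈ c, x < cutPoint a (q.1.erase b)),
      q.2.filter fun c => ¬ ∀ x ∈ c, x < cutPoint a (q.1.erase b))⟩) ?_ ?_ ?_ ?_ ?_
  · rintro ⟨v, ⟨S, π₁⟩, π₂⟩ hz
    simp only [mem_sigma, mem_Ico, mem_product, mem_pointedNC, mem_ncFamilies] at hz ⊢
    exact hz.2.1.glue hz.1.1 (by omega) hz.2.2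
  · rintro ⟨S, π⟩ hq
    simp only [mem_sigma, mem_Ico, mem_product, mem_pointedNC, mem_ncFamilies] at hq ⊢
    have := hq.cutPoint_erase_le hab
    exact ⟨⟨le_cutPoint _ _, by omega⟩, hq.split_left hab, hq.split_right hab⟩
  · rintro ⟨v, ⟨S, π₁⟩, π₂⟩ hz
    simp only [mem_sigma, mem_Ico, mem_product, mem_pointedNC, mem_ncFamilies] at hz
    obtain ⟨⟨hav, hvb⟩, h₁, h₂⟩ := hz
    have hbS : b ∉ S := fun hb => by
      have := h₁.bounds S (mem_insert_self _ _) b hb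
      omega
    have hcut := h₁.cutPoint_eq hav
    have hlt : ∀ c ∈ π₁, ∀ x ∈ c, x < v := fun c hc x hx =>
      (h₁.bounds c (mem_insert_of_mem hc) x hx).2
    have hge : ∀ c ∈ π₂, ¬ ∀ x ∈ c, x < v := by
      intro c hc hall
      obtain ⟨x, hx⟩ := h₂.nonempty c hc
      have := hall x hx
      have := h₂.bounds c hc x hx
      omega
    have hf1 : (π₁ ∪ π₂).filter (fun c => ∀ x ∈ c, x < v) = π₁ := by
      ext c
      simp only [mem_filter, mem_union]
      exact ⟨fun h => h.1.resolve_right fun h' => hge c h' h.2, fun h => ⟨Or.inl h, hlt c h⟩⟩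
    have hf2 : (π₁ ∪ π₂).filter (fun c => ¬ ∀ x ∈ c, x < v) = π₂ := by
      ext c
      simp only [mem_filter, mem_union]
      exact ⟨fun h => h.1.resolve_left fun h' => h.2 (hlt c h'), fun h => ⟨Or.inr h, hge c h⟩⟩
    simp only [erase_insert hbS, hcut, hf1, hf2]
  · rintro ⟨S, π⟩ hq
    rw [mem_pointedNC] at hq
    simp only [filter_union_filter_not_eq, insert_erase (hq.last_mem b hab rfl)]
  · rintro ⟨v, ⟨S, π₁⟩, π₂⟩ hz
    simp only [mem_sigma, mem_Ico, mem_product, mem_pointedNC, mem_ncFamilies] at hz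
    obtain ⟨⟨hav, hvb⟩, h₁, h₂⟩ := hz
    have hbS : b ∉ S := fun hb => by
      have := h₁.bounds S (mem_insert_self _ _) b hb
      omega
    have hdisj : Disjoint π₁ π₂ := by
      rw [disjoint_left]
      intro c hc₁ hc₂
      obtain ⟨x, hx⟩ := h₂.nonempty c hc₂
      have := h₁.bounds c (mem_insert_of_mem hc₁) x hx
      have := h₂.bounds c hc₂ x hx
      omega
    simp only [card_insert_of_notMem hbS, prod_union hdisj, mul_assoc]

theorem pointedSum_self (g h : ℕ → R) (a : ℕ) : pointedSum g h a a = h 0 := by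
  have : pointedNC a a = {(∅, ∅)} := by
    ext ⟨S, π⟩
    rw [mem_pointedNC, mem_singleton, Prod.mk.injEq]
    constructor
    · intro h
      have hS : ∀ c ∈ insert S π, c = ∅ := fun c hc => eq_empty_of_forall_notMem fun x hx => by
        have := h.bounds c hc x hx
        omega
      refine ⟨hS S (mem_insert_self _ _), eq_empty_of_forall_notMem fun c hc => ?_⟩
      exact (h.nonempty c hc).ne_empty (hS c (mem_insert_of_mem hc))
    · rintro ⟨rfl, rfl⟩
      refine ⟨by simp, by simp, fun x _ _ => by omega, by simp, ?_, fun x _ _ => by omega, by simp⟩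
      intro c hc d hd hne
      simp only [insert_empty_eq, mem_singleton] at hc hd
      exact absurd (hc.trans hd.symm) hne
  simp [pointedSum, this]

/-- Singling out the last block does not change the sum, if the weight of the missing block of the
empty partition is `1`. -/
theorem familySum_eq_pointedSum (g : ℕ → R) {a b : ℕ} (hab : a ≤ b) :
    familySum g a b = pointedSum g (fun k => if k = 0 then 1 else g k) a b := by
  rcases hab.eq_or_lt with rfl | hlt
  · rw [pointedSum_self]
    have : ncFamilies a a = {∅} := by
      ext π
      rw [mem_ncFamilies, mem_singleton]
      constructor
      · intro h
        refine eq_empty_of_forall_notMem fun c hc => ?_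
        obtain ⟨x, hx⟩ := h.nonempty c hc
        have := h.bounds c hc x hx
        omega
      · rintro rfl
        exact ⟨by simp, by simp, fun x _ _ => by omega, by simp, by simp [NoncrossingBlocks]⟩
    simp [familySum, this]
  obtain ⟨b, rfl⟩ : ∃ k, b = k + 1 := ⟨b - 1, by omega⟩
  have hab : a ≤ b := by omega
  symm
  refine sum_bij (fun q _ => insert q.1 q.2) ?_ ?_ ?_ ?_
  · rintro ⟨S, π⟩ hq
    rw [mem_pointedNC] at hq
    rw [mem_ncFamilies]
    refine ⟨?_, hq.bounds, hq.cover, hq.disj, hq.noncrossing⟩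
    intro c hc
    rcases mem_insert.1 hc with rfl | hc
    · exact ⟨b, hq.last_mem b hab rfl⟩
    · exact hq.nonempty c hc
  · rintro ⟨S, π⟩ hq ⟨S', π'⟩ hq' he
    rw [mem_pointedNC] at hq hq'
    simp only at he hq hq'
    have hS : S = S' := by
      refine hq'.disj S (he ▸ mem_insert_self _ _) S' (mem_insert_self _ _) b
        (hq.last_mem b hab rfl) (hq'.last_mem b hab rfl)
    subst hS
    rw [Prod.mk.injEq]
    refine ⟨rfl, ?_⟩
    rw [← erase_insert hq.notMem, he, erase_insert hq'.notMem]
  · intro π hπ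
    rw [mem_ncFamilies] at hπ
    obtain ⟨S, hS, hbS⟩ := hπ.cover b hab (by omega)
    refine ⟨(S, π.erase S), ?_, insert_erase hS⟩
    rw [mem_pointedNC]
    simp only
    have hins := insert_erase hS
    refine ⟨fun c hc => hπ.nonempty c (mem_of_mem_erase hc), ?_, ?_, ?_, ?_, ?_, by simp⟩
    · rw [hins]; exact hπ.bounds
    · rw [hins]; exact hπ.cover
    · rw [hins]; exact hπ.disj
    · rw [hins]; exact hπ.noncrossing
    · intro x _ hx
      obtain rfl : x = b := by omega
      exact hbS
  · rintro ⟨S, π⟩ hq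
    rw [mem_pointedNC] at hq
    have : #S ≠ 0 := (card_pos.2 ⟨b, hq.last_mem b hab rfl⟩).ne'
    simp only [this, if_false]
    rw [prod_insert hq.notMem]

/-- The sums over an interval depend on its length only. -/
theorem pointedSum_add (g : ℕ → R) (n : ℕ) : ∀ (h : ℕ → R) (a : ℕ),
    pointedSum g h a (a + n) = pointedSum g h 0 n := by
  induction n using Nat.strong_induction_on with
  | _ n ih =>
    intro h a
    cases n with
    | zero => rw [add_zero, pointedSum_self, pointedSum_self]
    | succ n =>
      rw [← add_assoc, pointedSum_succ g h (Nat.le_add_right a n),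
        pointedSum_succ g h (Nat.zero_le n), sum_Ico_eq_sum_range, sum_Ico_eq_sum_range]
      have : a + n + 1 - a = n + 1 - 0 := by omega
      rw [this]
      refine sum_congr rfl fun v hv => ?_
      rw [mem_range] at hv
      rw [ih v (by omega), zero_add, familySum_eq_pointedSum g (by omega),
        familySum_eq_pointedSum g (by omega)]
      have h1 : a + n = a + v + (n - v) := by omega
      have h2 : pointedSum g (fun k => if k = 0 then 1 else g k) v n =
        pointedSum g (fun k => if k = 0 then 1 else g k) v (v + (n - v)) := by
        congr 1; omega
      rw [h1, ih (n - v) (by omega), h2, ih (n - v) (by omega)]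

end Sums

/-! ### From partitions of `Fin n` to coefficients of composed power series. -/

namespace SetPartition

variable {R : Type*} [CommRing R]

/-- The blocks of a partition as sets of natural numbers. -/
def valBlocks {n : ℕ} : Finset (Fin n) ↪ Finset ℕ :=
  (Finset.mapEmbedding Fin.valEmbedding).toEmbedding

theorem mem_valBlocks {n : ℕ} {c : Finset (Fin n)} {x : ℕ} :
    x ∈ valBlocks c ↔ ∃ i ∈ c, (i : ℕ) = x := by
  simp [valBlocks]

theorem card_valBlocks {n : ℕ} (c : Finset (Fin n)) : #(valBlocks c) = #c := by
  simp [valBlocks]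

theorem insert_map_erase_part {m : ℕ} (P : SetPartition (m + 1)) (i : Fin (m + 1)) :
    insert (valBlocks (P.part i)) ((P.parts.erase (P.part i)).map valBlocks) =
      P.parts.map valBlocks := by
  rw [← map_insert, insert_erase (P.part_mem_parts i)]

theorem isPointedNC_of_mem_NC {m : ℕ} {P : SetPartition (m + 1)} (hP : P ∈ NC (m + 1)) :
    IsPointedNC 0 (m + 1) (valBlocks (P.part (Fin.last m)))
      ((P.parts.erase (P.part (Fin.last m))).map valBlocks) := by
  have hmem : ∀ {c}, c ∈ P.parts.map valBlocks ↔ ∃ d ∈ P.parts, valBlocks d = c := by simp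
  refine ⟨?_, ?_, ?_, ?_, ?_, ?_, ?_⟩
  · intro c hc
    obtain ⟨d, hd, rfl⟩ := mem_map.1 hc
    obtain ⟨i, hi⟩ := P.nonempty_of_mem_parts (mem_of_mem_erase hd)
    exact ⟨i, mem_valBlocks.2 ⟨i, hi, rfl⟩⟩
  · rw [insert_map_erase_part]
    intro c hc x hx
    obtain ⟨d, hd, rfl⟩ := hmem.1 hc
    obtain ⟨i, hi, rfl⟩ := mem_valBlocks.1 hx
    exact ⟨Nat.zero_le _, i.2⟩
  · rw [insert_map_erase_part]
    intro x _ hx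
    exact ⟨_, hmem.2 ⟨_, P.part_mem_parts ⟨x, hx⟩, rfl⟩,
      mem_valBlocks.2 ⟨⟨x, hx⟩, P.mem_part_iff.2 rfl, rfl⟩⟩
  · rw [insert_map_erase_part]
    intro c hc d hd x hxc hxd
    obtain ⟨c, hc', rfl⟩ := hmem.1 hc
    obtain ⟨d, hd', rfl⟩ := hmem.1 hd
    obtain ⟨i, hi, rfl⟩ := mem_valBlocks.1 hxc
    obtain ⟨j, hj, hij⟩ := mem_valBlocks.1 hxd
    obtain rfl := Fin.ext hij
    rw [P.eq_of_mem_parts hc' hd' hi hj]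
  · rw [insert_map_erase_part]
    rintro c hc d hd hne ⟨p, hp, q, hq, r, hr, s, hs, h1, h2, h3⟩
    obtain ⟨c, hc', rfl⟩ := hmem.1 hc
    obtain ⟨d, hd', rfl⟩ := hmem.1 hd
    obtain ⟨p, hp', rfl⟩ := mem_valBlocks.1 hp
    obtain ⟨q, hq', rfl⟩ := mem_valBlocks.1 hq
    obtain ⟨r, hr', rfl⟩ := mem_valBlocks.1 hr
    obtain ⟨s, hs', rfl⟩ := mem_valBlocks.1 hs
    have hnc : NoncrossingBlocks P.parts := by simpa [NC] using hP
    exact hnc c hc' d hd' (fun h => hne (by rw [h]))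
      ⟨p, hp', q, hq', r, hr', s, hs', h1, h2, h3⟩
  · intro x _ hx
    exact mem_valBlocks.2 ⟨Fin.last m, P.mem_part_iff.2 rfl, by simp; omega⟩
  · intro h
    obtain ⟨d, hd, he⟩ := mem_map.1 h
    exact ne_of_mem_erase hd (valBlocks.injective he)

theorem exists_map_valBlocks_eq {m : ℕ} {S : Finset ℕ} {π : Finset (Finset ℕ)}
    (h : IsPointedNC 0 (m + 1) S π) : ∃ P ∈ NC (m + 1),
      valBlocks (P.part (Fin.last m)) = S ∧
        (P.parts.erase (P.part (Fin.last m))).map valBlocks = π := by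
  let pre : Finset ℕ → Finset (Fin (m + 1)) := fun c => univ.filter fun i => (i : ℕ) ∈ c
  have hmpre : ∀ {c : Finset ℕ} {i : Fin (m + 1)}, i ∈ pre c ↔ (i : ℕ) ∈ c := by simp [pre]
  have hpre : ∀ c ∈ insert S π, valBlocks (pre c) = c := by
    intro c hc
    ext x
    rw [mem_valBlocks]
    constructor
    · rintro ⟨i, hi, rfl⟩
      exact hmpre.1 hi
    · intro hx
      exact ⟨⟨x, (h.bounds c hc x hx).2⟩, hmpre.2 hx, rfl⟩
  have hlast : m ∈ S := h.last_mem m (Nat.zero_le _) rfl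
  let P : SetPartition (m + 1) := Finpartition.ofExistsUnique ((insert S π).image pre)
    (fun _ _ => subset_univ _)
    (by
      intro i _
      obtain ⟨c, hc, hic⟩ := h.cover i (Nat.zero_le _) i.2
      refine ⟨pre c, ⟨mem_image_of_mem _ hc, hmpre.2 hic⟩, ?_⟩
      rintro d ⟨hd, hid⟩
      obtain ⟨d, hd', rfl⟩ := mem_image.1 hd
      rw [h.disj c hc d hd' i hic (hmpre.1 hid)])
    (by
      intro he
      obtain ⟨c, hc, hce⟩ := mem_image.1 he
      have : c.Nonempty := by
        rcases mem_insert.1 hc with rfl | hc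
        · exact ⟨m, hlast⟩
        · exact h.nonempty c hc
      rw [← hpre c hc, hce] at this
      simp [valBlocks] at this)
  have hparts : P.parts = (insert S π).image pre := rfl
  have hpart : P.part (Fin.last m) = pre S :=
    P.part_eq_of_mem (hparts ▸ mem_image_of_mem _ (mem_insert_self _ _)) (hmpre.2 (by simpa))
  have hmap : P.parts.map valBlocks = insert S π := by
    ext c
    rw [hparts]
    simp only [mem_map, mem_image]
    constructor
    · rintro ⟨_, ⟨d, hd, rfl⟩, rfl⟩
      rwa [hpre d hd]
    · intro hc
      exact ⟨_, ⟨c, hc, rfl⟩, hpre c hc⟩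
  refine ⟨P, ?_, ?_, ?_⟩
  · have : NoncrossingBlocks P.parts := by
      rintro c hc d hd hne ⟨p, hp, q, hq, r, hr, s, hs, h1, h2, h3⟩
      refine h.noncrossing (valBlocks c) (hmap ▸ mem_map_of_mem _ hc) (valBlocks d)
        (hmap ▸ mem_map_of_mem _ hd) (fun he => hne (valBlocks.injective he))
        ⟨p, mem_valBlocks.2 ⟨p, hp, rfl⟩, q, mem_valBlocks.2 ⟨q, hq, rfl⟩, r,
          mem_valBlocks.2 ⟨r, hr, rfl⟩, s, mem_valBlocks.2 ⟨s, hs, rfl⟩, h1, h2, h3⟩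
    simpa [NC] using this
  · rw [hpart, hpre S (mem_insert_self _ _)]
  · rw [map_erase, hmap, hpart, hpre S (mem_insert_self _ _), erase_insert h.notMem]

theorem sum_NC_eq_pointedSum (g h : ℕ → R) (m : ℕ) :
    ∑ P ∈ NC (m + 1), h #(P.part (Fin.last m)) * ∏ c ∈ P.parts.erase (P.part (Fin.last m)), g #c =
      pointedSum g h 0 (m + 1) := by
  refine sum_bij (fun P _ => (valBlocks (P.part (Fin.last m)),
    (P.parts.erase (P.part (Fin.last m))).map valBlocks)) ?_ ?_ ?_ ?_
  · intro P hP
    exact mem_pointedNC.2 (isPointedNC_of_mem_NC hP)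
  · intro P _ Q _ he
    rw [Prod.mk.injEq] at he
    have := insert_map_erase_part P (Fin.last m)
    rw [he.1, he.2, insert_map_erase_part] at this
    exact Finpartition.ext (map_injective _ this.symm)
  · rintro ⟨S, π⟩ hq
    obtain ⟨P, hP, h1, h2⟩ := exists_map_valBlocks_eq (mem_pointedNC.1 hq)
    exact ⟨P, hP, by rw [h1, h2]⟩
  · intro P _
    simp only [card_valBlocks, prod_map]

theorem coeff_one_add_freeTransform (κ : PowerSeries R) (n : ℕ) :
    PowerSeries.coeff n (1 + Meandric.freeTransform κ) =
      familySum (fun k => PowerSeries.coeff k κ) 0 n := by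
  rw [familySum_eq_pointedSum _ (Nat.zero_le n)]
  cases n with
  | zero => simp [pointedSum_self, Meandric.freeTransform, Meandric.seriesFromOne]
  | succ m =>
    rw [← sum_NC_eq_pointedSum, map_add, PowerSeries.coeff_one, if_neg (Nat.succ_ne_zero m),
      zero_add, Meandric.freeTransform, Meandric.seriesFromOne, PowerSeries.coeff_mk,
      if_neg (Nat.succ_ne_zero m)]
    refine sum_congr rfl fun P _ => ?_
    have hne : #(P.part (Fin.last m)) ≠ 0 := by
      rw [card_ne_zero]
      exact ⟨_, P.mem_part_iff.2 rfl⟩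
    rw [if_neg hne, mul_prod_erase P.parts (fun c => PowerSeries.coeff #c κ)
      (P.part_mem_parts _)]

theorem hasSubst_X_mul (f : PowerSeries R) : PowerSeries.HasSubst (PowerSeries.X * f) :=
  PowerSeries.HasSubst.of_constantCoeff_zero' (by simp)

/-- The coefficients of `h (X (1 + ĝ))` are sums over non-crossing partitions, with `h` at the size
of the block of the last point and `g` at the sizes of the other blocks. -/
theorem coeff_subst_X_mul_freeTransform (κ : PowerSeries R) (n : ℕ) : ∀ h : PowerSeries R,
    PowerSeries.coeff n (h.subst (PowerSeries.X * (1 + Meandric.freeTransform κ))) =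
      pointedSum (fun k => PowerSeries.coeff k κ) (fun k => PowerSeries.coeff k h) 0 n := by
  have hU := hasSubst_X_mul (1 + Meandric.freeTransform κ)
  -- Writing `h = h'·X + h(0)` gives `h(U) = h'(U)·U + h(0)` with `U = X(1 + ĝ)`. The shift from `h`
  -- to `h'` and the factor `1 + ĝ` reproduce the recursion `pointedSum_succ`.
  have hrec : ∀ h : PowerSeries R,
      h.subst (PowerSeries.X * (1 + Meandric.freeTransform κ)) =
        (PowerSeries.mk fun p => PowerSeries.coeff (p + 1) h).subst
          (PowerSeries.X * (1 + Meandric.freeTransform κ)) *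
          (PowerSeries.X * (1 + Meandric.freeTransform κ)) +
          PowerSeries.C (PowerSeries.constantCoeff h) := by
    intro h
    conv_lhs => rw [PowerSeries.eq_shift_mul_X_add_const h]
    rw [PowerSeries.subst_add hU, PowerSeries.subst_mul hU, PowerSeries.subst_X hU]
    congr 1
    exact PowerSeries.subst_C _
  induction n using Nat.strong_induction_on with
  | _ n ih =>
    intro h
    rw [hrec]
    cases n with
    | zero => simp [pointedSum_self]
    | succ n =>
      rw [map_add, PowerSeries.coeff_C, if_neg (Nat.succ_ne_zero n), add_zero,
        mul_left_comm, PowerSeries.coeff_succ_X_mul, PowerSeries.coeff_mul,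
        Finset.Nat.sum_antidiagonal_eq_sum_range_succ_mk,
        pointedSum_succ _ _ (Nat.zero_le n), ← Nat.Ico_zero_eq_range]
      refine sum_congr rfl fun v hv => ?_
      rw [mem_Ico] at hv
      rw [ih v (by omega), coeff_one_add_freeTransform]
      congr 1
      · simp
      · rw [familySum_eq_pointedSum _ (by omega), familySum_eq_pointedSum _ (by omega),
          ← pointedSum_add _ (n - v) _ v]
        congr 1
        omega

end SetPartition

/-! ### Sums over subsets, block by block. -/

section BlockSubsets

variable {R : Type*} [CommRing R] {ι : Type*}

theorem sum_powerset_pow_card_sub (x : R) (c : Finset ι) :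
    ∑ s ∈ c.powerset, x ^ (#c - #s) = (1 + x) ^ #c := by
  simpa using sum_pow_mul_eq_add_pow (1 : R) x c

variable [DecidableEq ι]

/-- A subset of a disjoint union of blocks is a choice of a subset of every block. -/
theorem sum_powerset_biUnion_prod (f : Finset ι → Finset ι → R) (π : Finset (Finset ι))
    (hπ : (π : Set (Finset ι)).PairwiseDisjoint id) :
    ∑ T ∈ (π.biUnion id).powerset, ∏ c ∈ π, f c (T ∩ c) =
      ∏ c ∈ π, ∑ s ∈ c.powerset, f c s := by
  induction π using Finset.induction_on with
  | empty => simp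
  | insert c π hc ih =>
    have hπ' : (π : Set (Finset ι)).PairwiseDisjoint id :=
      hπ.subset (by simp)
    have hdisj : ∀ d ∈ π, Disjoint c d := fun d hd =>
      hπ (by simp) (by simp [hd]) (by rintro rfl; exact hc hd)
    have hdisjU : Disjoint c (π.biUnion id) := by
      rw [disjoint_biUnion_right]
      exact hdisj
    rw [prod_insert hc, ← ih hπ', sum_mul_sum, ← sum_product', biUnion_insert, id_eq]
    refine sum_nbij' (fun T => (T ∩ c, T ∩ π.biUnion id)) (fun z => z.1 ∪ z.2) ?_ ?_ ?_ ?_ ?_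
    · intro T _
      simp only [mem_product, mem_powerset]
      exact ⟨inter_subset_right, inter_subset_right⟩
    · rintro ⟨s, t⟩ hz
      simp only [mem_product, mem_powerset] at hz ⊢
      exact union_subset_union hz.1 hz.2
    · intro T hT
      rw [mem_powerset] at hT
      rw [← inter_union_distrib_left, inter_eq_left.2 hT]
    · rintro ⟨s, t⟩ hz
      simp only [mem_product, mem_powerset] at hz
      have h1 : t ∩ c = ∅ := disjoint_iff_inter_eq_empty.1 (hdisjU.symm.mono_left hz.2)
      have h2 : s ∩ π.biUnion id = ∅ := disjoint_iff_inter_eq_empty.1 (hdisjU.mono_left hz.1)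
      simp only [union_inter_distrib_right, h1, h2, union_empty, empty_union,
        inter_eq_left.2 hz.1, inter_eq_left.2 hz.2]
    · intro T _
      rw [prod_insert hc]
      congr 1
      refine prod_congr rfl fun d hd => ?_
      congr 1
      rw [inter_assoc, inter_eq_right.2 (show d ⊆ π.biUnion id from subset_biUnion_of_mem id hd)]

theorem sum_powerset_mem_pow_card_sub (x : R) {c : Finset ι} {i : ι} (hi : i ∈ c) :
    ∑ s ∈ c.powerset with i ∈ s, x ^ (#c - #s) = (1 + x) ^ (#c - 1) := by
  rw [← card_erase_of_mem hi, ← sum_powerset_pow_card_sub]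
  refine sum_nbij' (fun s => s.erase i) (fun s => insert i s) ?_ ?_ ?_ ?_ ?_
  · intro s hs
    simp only [mem_filter, mem_powerset] at hs ⊢
    exact erase_subset_erase i hs.1
  · intro s hs
    simp only [mem_filter, mem_powerset] at hs ⊢
    exact ⟨insert_subset hi (hs.trans (erase_subset _ _)), mem_insert_self _ _⟩
  · intro s hs
    exact insert_erase (mem_filter.1 hs).2
  · intro s hs
    exact erase_insert fun h => by simpa using mem_powerset.1 hs h
  · intro s hs
    have hs' := (mem_filter.1 hs).2
    have := card_pos.2 ⟨i, hs'⟩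
    rw [card_erase_of_mem hi, card_erase_of_mem hs']
    congr 1
    omega

end BlockSubsets

/-! ### Lengths of complements, and the meet condition. -/

namespace SetPartition

variable {m : ℕ}

/-- With this, `permLength_oneBlock_inv_mul` also yields the exponents of `A` and `B`: take `P` to
be the one-block partition, or take `T = univ`. -/
theorem perm_oneBlock_univ : (oneBlock (univ : Finset (Fin (m + 1)))).perm = finRotate (m + 1) := by
  ext1 i
  rcases eq_or_ne i (Fin.last m) with rfl | hi
  · rw [finRotate_last]
    exact perm_oneBlock_max (mem_univ _) (mem_univ _) (fun r _ => Fin.zero_le r)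
      fun r _ => Fin.le_last r
  · have := coe_finRotate_of_ne_last hi
    refine perm_eq_of_lt _ (part_oneBlock_eq_iff.2 (Or.inr ⟨mem_univ _, mem_univ _⟩)) ?_ ?_
    · rw [Fin.lt_def]; omega
    · intro k hk hk'
      rw [Fin.lt_def] at hk hk'
      omega

theorem permLength_oneBlock_inv_mul_finRotate {T : Finset (Fin (m + 1))} (hT : T.Nonempty) :
    permLength ((oneBlock T).perm⁻¹ * finRotate (m + 1)) = m + 1 - #T := by
  have h := permLength_oneBlock_inv_mul (oneBlock_mem_NC univ) T hT
  have hpart : (oneBlock (univ : Finset (Fin (m + 1)))).part 0 = univ := by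
    ext i
    simp [mem_part_iff, part_oneBlock_eq_iff]
  have hparts : (oneBlock (univ : Finset (Fin (m + 1)))).parts = {univ} := by
    ext c
    rw [mem_singleton]
    constructor
    · intro hc
      obtain ⟨i, rfl⟩ := exists_part_eq _ hc
      ext j
      simp [mem_part_iff, part_oneBlock_eq_iff]
    · rintro rfl
      have h0 := part_mem_parts (oneBlock univ) (0 : Fin (m + 1))
      rwa [hpart] at h0
  rw [perm_oneBlock_univ, hparts, sum_singleton, inter_univ, blockLength,
    if_neg hT.ne_empty, card_univ, Fintype.card_fin] at h
  omega

theorem permLength_inv_mul_finRotate {P : SetPartition (m + 1)} (hP : P ∈ NC (m + 1)) :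
    permLength (P.perm⁻¹ * finRotate (m + 1)) = #P.parts - 1 := by
  have h := permLength_oneBlock_inv_mul hP univ univ_nonempty
  rw [perm_oneBlock_univ, ← permLength_inv, mul_inv_rev, inv_inv] at h
  have hs : ∑ c ∈ P.parts, blockLength c (univ ∩ c) = ∑ _c ∈ P.parts, 1 := by
    refine sum_congr rfl fun c hc => ?_
    rw [univ_inter, blockLength, if_neg (P.ne_empty hc)]
    omega
  rw [hs, sum_const, smul_eq_mul, mul_one] at h
  omega

/-- With `c` the full cycle, `(α⁻¹c)⁻¹(β⁻¹c) = c⁻¹(αβ⁻¹)c`, and `αβ⁻¹` is conjugate to the inverse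
of `α⁻¹β`. -/
theorem permLength_krew_inv_mul_krew {n : ℕ} {P Q : SetPartition n} (hP : P ∈ NC n)
    (hQ : Q ∈ NC n) :
    permLength ((krew P).perm⁻¹ * (krew Q).perm) = permLength (P.perm⁻¹ * Q.perm) := by
  have h : permLength (P.perm⁻¹ * Q.perm) = permLength (P.perm * Q.perm⁻¹) := by
    rw [← permLength_inv, mul_inv_rev, inv_inv, permLength_mul_comm]
  rw [perm_krew hP, perm_krew hQ, h, ← permLength_conj (P.perm * Q.perm⁻¹) (finRotate n)⁻¹]
  simp only [mul_inv_rev, inv_inv, mul_assoc]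

theorem permLength_krew_inv_mul_finRotate {n : ℕ} {P : SetPartition n} (hP : P ∈ NC n) :
    permLength ((krew P).perm⁻¹ * finRotate n) = permLength P.perm := by
  rw [perm_krew hP, ← permLength_conj P.perm (finRotate n)⁻¹]
  simp only [mul_inv_rev, inv_inv]

theorem oneBlock_injOn : Set.InjOn oneBlock
    ((univ.filter fun T : Finset (Fin (m + 1)) => Fin.last m ∈ T : Finset _) :
      Set (Finset (Fin (m + 1)))) := by
  intro T hT T' hT' h
  simp only [coe_filter, mem_univ, true_and, Set.mem_ofPred_eq] at hT hT'
  ext i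
  have h1 := part_oneBlock_eq_iff (T := T) (i := i) (j := Fin.last m)
  have h2 := part_oneBlock_eq_iff (T := T') (i := i) (j := Fin.last m)
  rw [h] at h1
  rcases eq_or_ne i (Fin.last m) with rfl | hi
  · exact ⟨fun _ => hT', fun _ => hT⟩
  · simp only [hi, hT, hT', false_or, and_true] at h1 h2
    exact h1.symm.trans h2

open Classical in
theorem Kr_Intv_eq_image : Kr (Intv (m + 1)) =
    (univ.filter fun T : Finset (Fin (m + 1)) => Fin.last m ∈ T).image oneBlock := by
  ext Q
  simp only [mem_Kr_Intv_iff, mem_image, mem_filter, mem_univ, true_and]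

/-- The elements of `Kr Int` below both partitions are the `oneBlock S` with the last point in `S`
and `S` contained in `T` and in the last block of `P`. The largest has `S` equal to their
intersection. -/
theorem isKrIntMeet_oneBlock_bot_iff {P : SetPartition (m + 1)} {T : Finset (Fin (m + 1))}
    (hT : Fin.last m ∈ T) :
    IsKrIntMeet (oneBlock T) P ⊥ ↔ T ∩ P.part (Fin.last m) = {Fin.last m} := by
  constructor
  · intro h
    set S := T ∩ P.part (Fin.last m) with hS
    have hlast : Fin.last m ∈ S := mem_inter.2 ⟨hT, P.mem_part_iff.2 rfl⟩
    have hmem : oneBlock S ≤ ⊥ := by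
      refine h.2 ⟨mem_Kr_Intv_iff.2 ⟨S, hlast, rfl⟩, ?_, ?_⟩
      · rw [le_iff_part]
        intro i j hij
        rw [part_oneBlock_eq_iff] at hij ⊢
        exact hij.imp_right fun h => ⟨(mem_inter.1 h.1).1, (mem_inter.1 h.2).1⟩
      · rw [le_iff_part]
        intro i j hij
        rcases part_oneBlock_eq_iff.1 hij with rfl | ⟨h1, h2⟩
        · rfl
        · exact (P.mem_part_iff.1 (mem_inter.1 h1).2).trans
            (P.mem_part_iff.1 (mem_inter.1 h2).2).symm
    refine eq_singleton_iff_unique_mem.2 ⟨hlast, fun i hi => ?_⟩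
    exact part_bot_eq_iff.1 ((le_iff_part _ _).1 hmem i _
      (part_oneBlock_eq_iff.2 (Or.inr ⟨hi, hlast⟩)))
  · intro h
    refine ⟨⟨mem_Kr_Intv_iff.2 ⟨{Fin.last m}, mem_singleton_self _, oneBlock_singleton _⟩,
      bot_le, bot_le⟩, ?_⟩
    rintro Q ⟨hQ, hQT, hQP⟩
    obtain ⟨S, hS, rfl⟩ := mem_Kr_Intv_iff.1 hQ
    have hsub : ∀ i ∈ S, i = Fin.last m := by
      intro i hi
      have hpart := part_oneBlock_eq_iff.2 (Or.inr ⟨hi, hS⟩ : i = Fin.last m ∨ i ∈ S ∧ _)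
      have h1 : i ∈ T := by
        rcases part_oneBlock_eq_iff.1 ((le_iff_part _ _).1 hQT _ _ hpart) with h | h
        · exact h ▸ hT
        · exact h.1
      have h2 : i ∈ P.part (Fin.last m) := P.mem_part_iff.2 ((le_iff_part _ _).1 hQP _ _ hpart)
      have : i ∈ T ∩ P.part (Fin.last m) := mem_inter.2 ⟨h1, h2⟩
      rw [h] at this
      exact mem_singleton.1 this
    rw [le_iff_part]
    intro i j hij
    rcases part_oneBlock_eq_iff.1 hij with rfl | ⟨h1, h2⟩
    · rfl
    · rw [hsub i h1, hsub j h2]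

end SetPartition

/-! ### Factorization of the weights and the generating functions. -/

namespace Meandric

open SetPartition

variable {R : Type*} [CommRing R]

/-- The weight of a pair of partitions in the cumulant series. -/
noncomputable def pairWeight (Y A B : R) {n : ℕ} (P Q : SetPartition n) : R :=
  Y ^ permLength (P.perm⁻¹ * Q.perm) * A ^ permLength (P.perm⁻¹ * finRotate n) *
    B ^ permLength (Q.perm⁻¹ * finRotate n)

/-- All three exponents are sums over blocks. The `+ 1` in the length formula cancels the one in the
`blockLength` of the last block, and `B` counts the blocks other than the last. -/
theorem pairWeight_oneBlock (Y A B : R) {m : ℕ} {P : SetPartition (m + 1)} (hP : P ∈ NC (m + 1))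
    {T : Finset (Fin (m + 1))} (hT : Fin.last m ∈ T) :
    pairWeight Y A B (oneBlock T) P =
      (A * Y) ^ (#(P.part (Fin.last m)) - #(T ∩ P.part (Fin.last m))) *
        ∏ c ∈ P.parts.erase (P.part (Fin.last m)),
          (B * A ^ (#c - #(T ∩ c)) * Y ^ blockLength c (T ∩ c)) := by
  set V := P.part (Fin.last m) with hVdef
  have hV : V ∈ P.parts := P.part_mem_parts _
  have hne : T.Nonempty := ⟨_, hT⟩
  have hTV : T ∩ V ≠ ∅ := Finset.Nonempty.ne_empty ⟨_, mem_inter.2 ⟨hT, P.mem_part_iff.2 rfl⟩⟩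
  have hY : permLength ((oneBlock T).perm⁻¹ * P.perm) =
      (#V - #(T ∩ V)) + ∑ c ∈ P.parts.erase V, blockLength c (T ∩ c) := by
    have h := permLength_oneBlock_inv_mul hP T hne
    have hl : blockLength V (T ∩ V) = #V - #(T ∩ V) + 1 := if_neg hTV
    rw [← add_sum_erase _ _ hV, hl] at h
    omega
  have hA : permLength ((oneBlock T).perm⁻¹ * finRotate (m + 1)) =
      (#V - #(T ∩ V)) + ∑ c ∈ P.parts.erase V, (#c - #(T ∩ c)) := by
    rw [permLength_oneBlock_inv_mul_finRotate hne, add_sum_erase P.parts (fun c => #c - #(T ∩ c)) hV,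
      sum_tsub_distrib _ fun c _ => card_le_card inter_subset_right, P.sum_card_parts, card_univ,
      Fintype.card_fin]
    congr 1
    rw [← card_biUnion]
    · congr 1
      ext i
      simp only [mem_biUnion, mem_inter]
      exact ⟨fun hi => ⟨_, P.part_mem_parts i, hi, P.mem_part_iff.2 rfl⟩, fun ⟨_, _, hi, _⟩ => hi⟩
    · intro c hc d hd hcd
      exact (P.disjoint hc hd hcd).mono inter_subset_right inter_subset_right
  have hB : permLength (P.perm⁻¹ * finRotate (m + 1)) = #(P.parts.erase V) := by
    rw [permLength_inv_mul_finRotate hP, card_erase_of_mem hV]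
  rw [pairWeight, hY, hA, hB, prod_mul_distrib, prod_mul_distrib, prod_const, prod_pow_eq_pow_sum,
    prod_pow_eq_pow_sum, pow_add, pow_add, mul_pow]
  ring

theorem sum_powerset_blockWeight (Y : Rˣ) (A B : R) {n : ℕ} {c : Finset (Fin n)}
    (hc : c.Nonempty) :
    ∑ s ∈ c.powerset, B * A ^ (#c - #s) * (Y : R) ^ blockLength c s =
      PowerSeries.coeff #c (gSeries Y A B) := by
  have hcard : #c ≠ 0 := (card_pos.2 hc).ne'
  -- A nonempty trace has weight `BY(AY)^(|c|-|s|)`. The empty one has `Y^(|c|-1)` in place of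
  -- `Y^(|c|+1)`, which produces the term with `Y⁻² - 1` in `g`.
  have hterm : ∀ s ∈ c.powerset, B * A ^ (#c - #s) * (Y : R) ^ blockLength c s =
      B * Y * (A * Y) ^ (#c - #s) +
        if s = ∅ then B * Y * ((A * Y) ^ #c * (((Y⁻¹ : Rˣ) : R) ^ 2 - 1)) else 0 := by
    intro s _
    by_cases hs : s = ∅
    · subst hs
      have hY : (Y : R) * ((Y⁻¹ : Rˣ) : R) = 1 := Y.mul_inv
      obtain ⟨k, hk⟩ := Nat.exists_eq_succ_of_ne_zero hcard
      rw [blockLength, if_pos rfl, if_pos rfl, card_empty, hk]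
      simp only [Nat.succ_eq_add_one, Nat.add_sub_cancel, Nat.sub_zero]
      have : (Y : R) * (Y : R) ^ (k + 1) * ((Y⁻¹ : Rˣ) : R) ^ 2 = (Y : R) ^ k := by
        calc (Y : R) * (Y : R) ^ (k + 1) * ((Y⁻¹ : Rˣ) : R) ^ 2
            = (Y : R) ^ k * ((Y : R) * ((Y⁻¹ : Rˣ) : R)) ^ 2 := by ring
          _ = (Y : R) ^ k := by rw [hY]; ring
      rw [← this]
      ring
    · rw [blockLength, if_neg hs, if_neg hs]
      ring
  rw [sum_congr rfl hterm, sum_add_distrib, ← mul_sum, sum_powerset_pow_card_sub,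
    sum_ite_eq_of_mem' _ _ _ (empty_mem_powerset c), gSeries, seriesFromOne, PowerSeries.coeff_mk,
    if_neg hcard]
  ring

/-- Summing the weights over the subsets `T` whose trace on the last block satisfies `p`
factorizes over the blocks. -/
theorem sum_pairWeight_oneBlock (Y : Rˣ) (A B : R) {m : ℕ} {P : SetPartition (m + 1)}
    (hP : P ∈ NC (m + 1)) (p : Finset (Fin (m + 1)) → Prop)
    [DecidablePred p] (hp : ∀ s, p s → Fin.last m ∈ s) :
    ∑ T : Finset (Fin (m + 1)) with p (T ∩ P.part (Fin.last m)),
        pairWeight (Y : R) A B (oneBlock T) P =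
      (∑ s ∈ (P.part (Fin.last m)).powerset with p s,
        (A * Y) ^ (#(P.part (Fin.last m)) - #s)) *
        ∏ c ∈ P.parts.erase (P.part (Fin.last m)), PowerSeries.coeff #c (gSeries Y A B) := by
  set V := P.part (Fin.last m) with hVdef
  have hV : V ∈ P.parts := P.part_mem_parts _
  -- The condition `p` concerns the trace on the last block only, so it enters as an indicator in
  -- the factor of that block.
  let f : Finset (Fin (m + 1)) → Finset (Fin (m + 1)) → R := fun c s =>
    if c = V then (if p s then (A * Y) ^ (#V - #s) else 0)
    else B * A ^ (#c - #s) * (Y : R) ^ blockLength c s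
  have hf : ∀ T : Finset (Fin (m + 1)), (if p (T ∩ V) then
      pairWeight (Y : R) A B (oneBlock T) P else 0) = ∏ c ∈ P.parts, f c (T ∩ c) := by
    intro T
    rw [← mul_prod_erase P.parts _ hV]
    have hrest : ∏ c ∈ P.parts.erase V, f c (T ∩ c) =
        ∏ c ∈ P.parts.erase V, (B * A ^ (#c - #(T ∩ c)) * (Y : R) ^ blockLength c (T ∩ c)) :=
      prod_congr rfl fun c hc => if_neg (ne_of_mem_erase hc)
    have hfV : f V (T ∩ V) = if p (T ∩ V) then (A * Y) ^ (#V - #(T ∩ V)) else 0 := if_pos rfl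
    rw [hrest, hfV]
    by_cases hpT : p (T ∩ V)
    · rw [if_pos hpT, if_pos hpT, pairWeight_oneBlock _ _ _ hP (mem_inter.1 (hp _ hpT)).1]
    · rw [if_neg hpT, if_neg hpT, zero_mul]
  rw [sum_filter, sum_congr rfl fun T _ => hf T]
  have huniv : (univ : Finset (Finset (Fin (m + 1)))) = (P.parts.biUnion id).powerset := by
    rw [P.biUnion_parts, powerset_univ]
  rw [huniv, sum_powerset_biUnion_prod f P.parts P.disjoint, ← mul_prod_erase P.parts _ hV]
  congr 1
  · rw [sum_filter]
    exact sum_congr rfl fun s _ => if_pos rfl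
  · refine prod_congr rfl fun c hc => ?_
    rw [← sum_powerset_blockWeight Y A B (P.nonempty_of_mem_parts (mem_of_mem_erase hc))]
    exact sum_congr rfl fun s _ => if_neg (ne_of_mem_erase hc)

/-- Passing to Kreweras complements preserves the exponent of `Y` and turns `‖α‖`, `‖β‖` into
lengths relative to the full cycle. -/
theorem coeff_momentSeries_eq_sum_pairWeight (Y A B : R) (m : ℕ) :
    PowerSeries.coeff (m + 1) (momentSeries Y A B) =
      ∑ P ∈ NC (m + 1), ∑ T : Finset (Fin (m + 1)) with Fin.last m ∈ T,
        pairWeight Y A B (oneBlock T) P := by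
  classical
  rw [momentSeries, seriesFromOne, PowerSeries.coeff_mk, if_neg (Nat.succ_ne_zero m)]
  have h1 : ∀ P ∈ Intv (m + 1), ∀ Q ∈ NC (m + 1),
      Y ^ permLength (P.perm⁻¹ * Q.perm) * A ^ permLength P.perm * B ^ permLength Q.perm =
        pairWeight Y A B (krew P) (krew Q) := by
    intro P hP Q hQ
    have hP' := Intv_subset_NC hP
    rw [pairWeight, permLength_krew_inv_mul_krew hP' hQ, permLength_krew_inv_mul_finRotate hP',
      permLength_krew_inv_mul_finRotate hQ]
  rw [sum_congr rfl fun P hP => sum_congr rfl (h1 P hP), sum_comm,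
    ← sum_image (f := fun Q => ∑ P ∈ Intv (m + 1), pairWeight Y A B (krew P) Q) krew_injOn_NC,
    ← Kr_eq_image Subset.rfl, Kr_NC]
  refine sum_congr rfl fun Q _ => ?_
  rw [← sum_image (f := fun P => pairWeight Y A B P Q)
    (krew_injOn_NC.mono (coe_subset.2 Intv_subset_NC)), ← Kr_eq_image Intv_subset_NC,
    Kr_Intv_eq_image, sum_image oneBlock_injOn]

theorem coeff_cumulantSeries_eq_sum_pairWeight (Y A B : R) (m : ℕ) :
    PowerSeries.coeff (m + 1) (cumulantSeries Y A B) =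
      ∑ P ∈ NC (m + 1),
        ∑ T : Finset (Fin (m + 1)) with T ∩ P.part (Fin.last m) = {Fin.last m},
          pairWeight Y A B (oneBlock T) P := by
  classical
  rw [cumulantSeries, seriesFromOne, PowerSeries.coeff_mk, if_neg (Nat.succ_ne_zero m), sum_filter,
    sum_product_right, Kr_NC]
  refine sum_congr rfl fun P _ => ?_
  rw [Kr_Intv_eq_image, sum_image oneBlock_injOn, sum_filter, sum_filter]
  refine sum_congr rfl fun T _ => ?_
  by_cases hT : Fin.last m ∈ T
  · rw [if_pos hT]
    exact if_congr (isKrIntMeet_oneBlock_bot_iff hT) rfl rfl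
  · rw [if_neg hT, if_neg]
    intro h
    have : Fin.last m ∈ T ∩ P.part (Fin.last m) := h ▸ mem_singleton_self _
    exact hT (mem_inter.1 this).1

theorem cumulantSeries_eq_subst (Y : Rˣ) (A B : R) :
    cumulantSeries (Y : R) A B =
      (hSeries (Y : R) A).subst (PowerSeries.X * (1 + freeTransform (gSeries Y A B))) := by
  ext n
  rw [coeff_subst_X_mul_freeTransform]
  cases n with
  | zero => simp [pointedSum_self, cumulantSeries, hSeries, seriesFromOne]
  | succ m =>
    rw [coeff_cumulantSeries_eq_sum_pairWeight, ← sum_NC_eq_pointedSum]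
    refine sum_congr rfl fun P hP => ?_
    rw [sum_pairWeight_oneBlock Y A B hP (fun s => s = {Fin.last m})
      (fun s hs => hs ▸ mem_singleton_self _)]
    congr 1
    have hlast : Fin.last m ∈ P.part (Fin.last m) := P.mem_part_iff.2 rfl
    have hne : #(P.part (Fin.last m)) ≠ 0 := (card_pos.2 ⟨_, hlast⟩).ne'
    rw [sum_filter, sum_ite_eq_of_mem' _ _ _ (mem_powerset.2 (singleton_subset_iff.2 hlast)),
      card_singleton, hSeries, seriesFromOne, PowerSeries.coeff_mk, if_neg hne]

/-- The series `∑_{n ≥ 1} x ^ (n - 1) X ^ n`. -/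
noncomputable def geomSeries (x : R) : PowerSeries R := seriesFromOne fun n => x ^ (n - 1)

/-- The trace on the last block is an arbitrary subset containing the last point, so the binomial
formula gives `(1+AY)^(|V|-1)`. -/
theorem momentSeries_eq_subst (Y : Rˣ) (A B : R) :
    momentSeries (Y : R) A B =
      (geomSeries (1 + A * (Y : R))).subst
        (PowerSeries.X * (1 + freeTransform (gSeries Y A B))) := by
  ext n
  rw [coeff_subst_X_mul_freeTransform]
  cases n with
  | zero => simp [pointedSum_self, momentSeries, geomSeries, seriesFromOne]
  | succ m =>
    rw [coeff_momentSeries_eq_sum_pairWeight, ← sum_NC_eq_pointedSum]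
    refine sum_congr rfl fun P hP => ?_
    have hlast : Fin.last m ∈ P.part (Fin.last m) := P.mem_part_iff.2 rfl
    have hne : #(P.part (Fin.last m)) ≠ 0 := (card_pos.2 ⟨_, hlast⟩).ne'
    have h := sum_pairWeight_oneBlock Y A B hP (fun s => Fin.last m ∈ s) (fun s hs => hs)
    simp only [mem_inter, hlast, and_true] at h
    rw [sum_powerset_mem_pow_card_sub _ hlast] at h
    rw [h, geomSeries, seriesFromOne, PowerSeries.coeff_mk, if_neg hne]

theorem geomSeries_mul (x : R) : geomSeries x * (1 - PowerSeries.C x * PowerSeries.X) =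
    PowerSeries.X := by
  have : geomSeries x = PowerSeries.X + PowerSeries.C x * (PowerSeries.X * geomSeries x) := by
    ext n
    cases n with
    | zero => simp [geomSeries, seriesFromOne]
    | succ n =>
      rw [map_add, PowerSeries.coeff_C_mul, PowerSeries.coeff_succ_X_mul, PowerSeries.coeff_X]
      cases n with
      | zero => simp [geomSeries, seriesFromOne]
      | succ n => simp [geomSeries, seriesFromOne, pow_succ']
  linear_combination this

theorem geomSeries_subst_mul (x : R) {U : PowerSeries R} (hU : PowerSeries.HasSubst U) :
    (geomSeries x).subst U * (1 - PowerSeries.C x * U) = U := by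
  have h := congrArg (PowerSeries.substAlgHom hU) (geomSeries_mul x)
  rw [map_mul, map_sub, map_one, map_mul, PowerSeries.coe_substAlgHom, PowerSeries.subst_X hU] at h
  have hC : (PowerSeries.C x).subst U = PowerSeries.C x := PowerSeries.subst_C x
  rwa [hC] at h

end Meandric

theorem theorem5p1 {R : Type*} [CommRing R] (Y : Rˣ) (A B : R) :
    PowerSeries.HasSubst
        (PowerSeries.X * (1 + Meandric.freeTransform (Meandric.gSeries Y A B))) ∧
      Meandric.cumulantSeries (Y : R) A B =
        (Meandric.hSeries (Y : R) A).subst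
          (PowerSeries.X * (1 + Meandric.freeTransform (Meandric.gSeries Y A B))) ∧
      IsUnit (1 - Meandric.cumulantSeries (Y : R) A B) ∧
      Meandric.momentSeries (Y : R) A B =
        Meandric.cumulantSeries (Y : R) A B *
          Ring.inverse (1 - Meandric.cumulantSeries (Y : R) A B) := by
  have hU := SetPartition.hasSubst_X_mul (1 + Meandric.freeTransform (Meandric.gSeries Y A B))
  have hK := Meandric.cumulantSeries_eq_subst Y A B
  have hM := Meandric.momentSeries_eq_subst Y A B
  have hunit : IsUnit (1 - Meandric.cumulantSeries (Y : R) A B) := by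
    rw [PowerSeries.isUnit_iff_constantCoeff]
    simp [Meandric.cumulantSeries, Meandric.seriesFromOne]
  refine ⟨hU, hK, hunit, ?_⟩
  have h1 := Meandric.geomSeries_subst_mul (A * (Y : R)) hU
  have h2 := Meandric.geomSeries_subst_mul (1 + A * (Y : R)) hU
  rw [← hM] at h2
  -- `hSeries Y A` and `geomSeries (A * Y)` agree by definition, so `K` is geometric in `U` just as
  -- `M` is.
  have hK' : (Meandric.geomSeries (A * (Y : R))).subst
      (PowerSeries.X * (1 + Meandric.freeTransform (Meandric.gSeries Y A B))) =
      Meandric.cumulantSeries (Y : R) A B := hK.symm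
  rw [hK'] at h1
  set U := PowerSeries.X * (1 + Meandric.freeTransform (Meandric.gSeries Y A B)) with hUdef
  set K := Meandric.cumulantSeries (Y : R) A B
  set M := Meandric.momentSeries (Y : R) A B
  have hunit' : IsUnit (1 - PowerSeries.C (A * (Y : R)) * U) := by
    rw [PowerSeries.isUnit_iff_constantCoeff]
    simp [hUdef]
  have key : M * (1 - K) = K := by
    -- With `a = AY`, the relations `K(1-aU) = U` and `M(1-(1+a)U) = U` give `M(1-K)(1-aU) = M(1-aU)
    -- - MU = U = K(1-aU)`, and `1-aU` is a unit.
    refine hunit'.mul_right_cancel ?_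
    rw [map_add, map_one] at h2
    linear_combination h2 - (1 + M) * h1
  calc M = M * ((1 - K) * Ring.inverse (1 - K)) := by
        rw [Ring.mul_inverse_cancel _ hunit, mul_one]
    _ = K * Ring.inverse (1 - K) := by rw [← mul_assoc, key]
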